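/- All graphs are finite and simple. Let $\Sigma$ be a closed connected surface (orientable or not) of Euler genus $g$, and let $a,m\ge 0$ be integers. Let $G$ be a graph and let $G_0,G_1,\ldots,G_m$ be subgraphs of $G$ such that $G=G_0\cup G_1\cup\cdots\cup G_m$, the subgraphs $G_1,\ldots,G_m$ are pairwise vertex-disjoint, and $G$ contains no edge between $V(G_i)$ and $V(G_j)$ for $1\le i<j\le m$. Suppose that $G_0$ is $2$-cell embedded in $\Sigma$ (so $G_0$ is connected and every face is homeomorphic to an open disk), and that there are pairwise distinct faces $f_1,\ldots,f_m$ of this embedding such that for $1\le i\le m$ every vertex of $V(G_i)\cap V(G_0)$ lies in the boundary of $f_i$. If each of $G_1,\ldots,G_m$ has tree-width at most $a$, then there exists a set $L_0\subseteq V(G_0)$ such that $G_0-L_0$ is planar and the graph $G_0[L_0]\cup G_1\cup\cdots\cup G_m$ has tree-width at most $26g+9m+a$. Here $2$-cell embeddings are given, as usual, by embedding schemes (a cyclic ordering of the edges around each vertex, together with a sign $\pm1$ for each edge); the faces are the facial walks traced out by the scheme (a one-vertex graph has one face), and the Euler genus of the surface is $g=2-|V(G_0)|+|E(G_0)|-|F|$,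 where $F$ is the set of faces. A graph is planar if each of its components has such an embedding of Euler genus $0$. -/

import Mathlib

namespace SimpleGraph

/-! ### Tree decompositions and tree-width -/

/-- A tree decomposition `(T, β)` of the graph `G`, with a finite tree `T`. -/
structure TreeDecomposition {V : Type*} (G : SimpleGraph V) where
  /-- the nodes of the tree -/
  Node : Type
  finite_node : Finite Node
  /-- the tree `T` -/
  tree : SimpleGraph Node
  isTree : tree.IsTree
  /-- the bags `β(z)` -/
  bag : Node → Finset V
  exists_bag_of_adj : ∀ u v : V, G.Adj u v → ∃ z, u ∈ bag z ∧ v ∈ bag z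
  /-- the nodes whose bags contain `v` induce a non-empty connected subtree -/
  connected_nodes : ∀ v : V, (tree.induce {z | v ∈ bag z}).Connected

/-- The width of a tree decomposition, `max |β(z)| - 1`. -/
noncomputable def TreeDecomposition.width {V : Type*} {G : SimpleGraph V}
    (D : G.TreeDecomposition) : ℤ :=
  ((⨆ z, (D.bag z).card : ℕ) : ℤ) - 1

/-- The tree-width of a finite graph: the minimum width of its tree decompositions
(it is `-1` for the graph without vertices). -/
noncomputable def treewidth {V : Type*} (G : SimpleGraph V) : ℤ :=
  sInf (Set.range fun D : G.TreeDecomposition => D.width)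

/-- A finite graph has a tree decomposition (a single bag). -/
theorem nonempty_treeDecomposition {V : Type*} [Finite V] (G : SimpleGraph V) :
    Nonempty G.TreeDecomposition := by
  classical
  have := Fintype.ofFinite V
  refine ⟨⟨Unit, inferInstance, ⊥, ?_, fun _ => Finset.univ, ?_, ?_⟩⟩
  · exact IsTree.of_subsingleton
  · exact fun u v _ => ⟨(), Finset.mem_univ u, Finset.mem_univ v⟩
  · intro v
    have : Nonempty ({z : Unit | v ∈ (Finset.univ : Finset V)} : Set Unit) :=
      ⟨⟨(), Finset.mem_univ v⟩⟩
    refine ⟨fun x y => ?_⟩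
    rw [Subsingleton.elim x y]

/-- The minimum in the definition of tree-width is attained: `G` has tree-width at most `k` if and
only if it has a tree decomposition all of whose bags have size at most `k + 1`. -/
theorem treewidth_le_iff {V : Type*} [Finite V] (G : SimpleGraph V) (k : ℕ) :
    G.treewidth ≤ k ↔ ∃ D : G.TreeDecomposition, ∀ z, (D.bag z).card ≤ k + 1 := by
  have key : ∀ D : G.TreeDecomposition, D.width ≤ k ↔ ∀ z, (D.bag z).card ≤ k + 1 := by
    intro D
    have := D.finite_node
    have : Nonempty D.Node := D.isTree.connected.nonempty
    rw [← ciSup_le_iff (Set.finite_range _).bddAbove]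
    unfold TreeDecomposition.width
    omega
  have hb : BddBelow (Set.range fun D : G.TreeDecomposition => D.width) := by
    refine ⟨-1, ?_⟩
    rintro _ ⟨D, rfl⟩
    simp only [TreeDecomposition.width]
    omega
  constructor
  · intro h
    obtain ⟨D⟩ := G.nonempty_treeDecomposition
    obtain ⟨D', hD'⟩ := Int.csInf_mem (Set.range_nonempty_iff_nonempty.mpr ⟨D⟩) hb
    exact ⟨D', (key D').mp (hD'.trans_le h)⟩
  · rintro ⟨D, hD⟩
    exact (csInf_le hb ⟨D, rfl⟩).trans ((key D).mpr hD)

/-! ### Embeddings of graphs in surfaces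

A 2-cell embedding of a connected graph in a closed surface (orientable or not) is given, up to
homeomorphism, by an embedding scheme (a rotation system with edge signatures), and every embedding
scheme of a connected finite graph arises in this way.  The faces are recovered by face tracing,
and the surface has Euler genus `g` with `|V| - |E| + |F| = 2 - g`. -/

/-- An embedding scheme of `G`: for each vertex `v` a cyclic ordering of the edges at `v`
(the restriction of `rot` to the darts leaving `v`), and a signature `+1` or `-1` for each edge,
which says whether the local orientations at its two ends agree along the edge.
A dart `d` is an edge directed from `d.fst` to `d.snd`. -/
structure EmbeddingScheme {V : Type*} (G : SimpleGraph V) where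
  /-- the next dart around the same vertex -/
  rot : Equiv.Perm G.Dart
  fst_rot : ∀ d, (rot d).fst = d.fst
  sameCycle_rot : ∀ d d' : G.Dart, d.fst = d'.fst → rot.SameCycle d d'
  /-- the signature of an edge -/
  sign : G.edgeSet → ℤˣ

namespace EmbeddingScheme

variable {V : Type*} {G : SimpleGraph V} (E : G.EmbeddingScheme)

/-- The signature of the edge underlying a dart. -/
def dartSign (d : G.Dart) : ℤˣ := E.sign ⟨d.edge, d.edge_mem⟩

/-- One step of face tracing.  The state `(d, ε)` means that we are about to walk along `d`, and
that `ε` tells whether the local orientation at `d.fst` is used as given (`1`) or reversed (`-1`).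
After walking along `d` the orientation changes by the signature of `d`, and we continue along
the next dart around `d.snd` with respect to the resulting orientation. -/
def faceStep (x : G.Dart × ℤˣ) : G.Dart × ℤˣ :=
  ((E.rot ^ ((x.2 * E.dartSign x.1 : ℤˣ) : ℤ)) x.1.symm, x.2 * E.dartSign x.1)

/-- The same side of the same edge, traversed in the opposite direction. -/
def faceReverse (x : G.Dart × ℤˣ) : G.Dart × ℤˣ :=
  (x.1.symm, -(x.2 * E.dartSign x.1))

/-- The facial walks that contain edges, up to the starting point and the direction
(`Quot` identifies along the equivalence relation generated by the given relation). -/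
def FacialWalk : Type _ :=
  Quot fun x y : G.Dart × ℤˣ => y = E.faceStep x ∨ y = E.faceReverse x

/-- The faces: the facial walks that contain edges, and for each isolated vertex
(a component embedded in a sphere of its own) the face around it. -/
def Face : Type _ := E.FacialWalk ⊕ {v : V // ∀ w, ¬ G.Adj v w}

/-- The set of vertices in the boundary of a face. -/
def boundary : E.Face → Set V
  | Sum.inl q => {v | ∃ x : G.Dart × ℤˣ, Quot.mk _ x = q ∧ x.1.fst = v}
  | Sum.inr v => {v.1}

/-- The Euler genus of the embedding, `2 - (|V| - |E| + |F|)` if `G` is connected; in general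
each component is embedded in a surface of its own, and this is the sum of the Euler genera. -/
noncomputable def eulerGenus : ℤ :=
  2 * (Nat.card G.ConnectedComponent : ℤ)
    - ((Nat.card V : ℤ) - (Nat.card G.edgeSet : ℤ) + (Nat.card E.Face : ℤ))

end EmbeddingScheme

/-- A finite graph is planar if its components can be embedded in the sphere. -/
def IsPlanar {V : Type*} (G : SimpleGraph V) : Prop :=
  ∃ E : G.EmbeddingScheme, E.eulerGenus = 0

end SimpleGraph

/-! The proof is homology modulo two. Even edge sets are cycles, and some of them bound a set of
faces. An embedding in which every cycle bounds has Euler genus 0, by a dimension count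
(`eulerGenus_eq_zero`). For a subgraph it suffices that its cycles bound in the ambient embedding
(`isPlanar_of_hom`). So `L₀` only has to meet every cycle that does not bound.

Root a breadth-first forest at the corners of the prescribed faces `F`. Each vertex owns one link:
the edge to its parent, or a corner in layer 0. Consider functions on flags that are constant along
the sides of edges and on the faces outside `F`. They form a space of dimension at least (faces
outside `F`) + (corners of `F`), and their jumps across the non-links determine them up to a
constant. There are |E| + (corners of `F`) - |V| non-links, so the jumps can be prescribed freely
off a set `X` of at most g + |F| - 1 of them (`exists_finset_jump`). Let `L` consist of the ends of
`X` and all their ancestors; it has at most 2(g + |F| - 1) vertices in each layer.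

A cycle z avoiding `L` bounds. Otherwise some functional c vanishes on the boundaries but not at z.
By duality c is the change along edges of a flag function p that is constant at corners
(`exists_primitive`). Adding a relative face function preserves this change and removes the jumps of
p off the links and `X`. The jumps around a vertex sum to zero, so working up from the deepest layer
no jump remains at vertices outside `L` (`eq_of_notMem`). There p depends on the vertex only, c is a
coboundary, and c(z) = 0, a contradiction.

All prescribed faces have their boundary in layer 0, so the attached graphs meet `L` only there.
Bags formed by two consecutive layers of `L`, glued to decompositions of the attached graphs
enlarged by layer 0, give the width (`treewidth_induce_sup_iSup_le`). -/

/-! ### Linear algebra -/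

/-- A subspace `W` of `K^ι` becomes everything after leaving out at most `|ι| - dim W`
coordinates. -/
theorem Submodule.exists_finset_forall_exists_mem_eq {K ι : Type*} [Field K] [Fintype ι]
    (W : Submodule K (ι → K)) :
    ∃ X : Finset ι, X.card + Module.finrank K W = Fintype.card ι ∧
      ∀ y : ι → K, ∃ w ∈ W, ∀ i ∉ X, w i = y i := by
  classical
  -- Images of unit vectors contain a basis of the quotient by `W`; its indices form `X`.
  obtain ⟨κ, a, ha, hspan, hli⟩ :=
    exists_linearIndependent' K (fun i : ι => W.mkQ (Pi.single i 1))
  have : Finite κ := Finite.of_injective a ha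
  have := Fintype.ofFinite κ
  have htop : Submodule.span K (Set.range fun i : ι => W.mkQ (Pi.single i (1 : K))) = ⊤ := by
    have h := (Pi.basisFun K ι).span_eq
    have h2 : (Set.range fun i : ι => W.mkQ (Pi.single i (1 : K))) =
        W.mkQ '' Set.range (Pi.basisFun K ι) := by
      rw [← Set.range_comp]
      congr 1
    rw [h2, ← Submodule.map_span, h, Submodule.map_top, Submodule.range_mkQ]
  rw [htop] at hspan
  refine ⟨Finset.univ.image a, ?_, fun y => ?_⟩
  · rw [Finset.card_image_of_injective _ ha, Finset.card_univ]
    have h1 := finrank_span_eq_card hli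
    rw [hspan, finrank_top] at h1
    have h2 := W.finrank_quotient_add_finrank
    rw [Module.finrank_fintype_fun_eq_card] at h2
    omega
  · have hy : W.mkQ y ∈ Submodule.span K (Set.range
        ((fun i : ι => W.mkQ (Pi.single i (1 : K))) ∘ a)) := by
      rw [hspan]; trivial
    rw [Submodule.mem_span_range_iff_exists_fun] at hy
    obtain ⟨c, hc⟩ := hy
    refine ⟨y - ∑ k, c k • Pi.single (a k) 1, ?_, fun i hi => ?_⟩
    · rw [← Submodule.Quotient.mk_eq_zero, ← Submodule.mkQ_apply, map_sub, map_sum, ← hc]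
      simp
    · simp only [Pi.sub_apply, Finset.sum_apply, Pi.smul_apply, sub_eq_self]
      refine Finset.sum_eq_zero fun k _ => ?_
      have : i ≠ a k := fun h => hi (by simp [h])
      simp [this]

/-- A linear functional on `K^ι` is given by its coefficients. -/
theorem LinearMap.apply_eq_sum_single {K ι : Type*} [Field K] [Fintype ι] [DecidableEq ι]
    (f : (ι → K) →ₗ[K] K) (y : ι → K) : f y = ∑ i, f (Pi.single i 1) * y i := by
  conv_lhs => rw [pi_eq_sum_univ' y]
  rw [map_sum]
  refine Finset.sum_congr rfl fun i _ => ?_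
  rw [map_smul, smul_eq_mul, mul_comm]

/-- Modulo two, adding the composition with an involution is a self-adjoint operation. -/
theorem sum_mul_add_comp_involutive {α : Type*} [Fintype α] {t : α → α}
    (ht : Function.Involutive t) (p q : α → ZMod 2) :
    ∑ x, q x * (p x + p (t x)) = ∑ x, p x * (q x + q (t x)) := by
  have h : ∑ x, q x * p (t x) = ∑ x, p x * q (t x) := by
    rw [← Equiv.sum_comp ht.toPerm]
    refine Finset.sum_congr rfl fun x _ => ?_
    simp [ht x, mul_comm]
  simp only [mul_add, Finset.sum_add_distrib, h]
  congr 1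
  exact Finset.sum_congr rfl fun x _ => mul_comm _ _

/-! ### Flags, face functions and boundaries modulo two -/

namespace SimpleGraph

variable {V : Type*} {G : SimpleGraph V}

/-- The edge underlying a dart, as an element of the edge set. -/
def Dart.toEdge (d : G.Dart) : G.edgeSet := ⟨d.edge, d.edge_mem⟩

theorem Dart.toEdge_symm (d : G.Dart) : d.symm.toEdge = d.toEdge :=
  Subtype.ext d.edge_symm

theorem Dart.toEdge_eq_iff {d d' : G.Dart} : d.toEdge = d'.toEdge ↔ d = d' ∨ d = d'.symm := by
  rw [← dart_edge_eq_iff]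
  exact Subtype.ext_iff

theorem Dart.toEdge_surjective : Function.Surjective (Dart.toEdge : G.Dart → G.edgeSet) := by
  rintro ⟨e, he⟩
  induction e with
  | h u v => exact ⟨⟨(u, v), he⟩, rfl⟩

/-- One of the two darts of an edge. -/
noncomputable def edgeDart (e : G.edgeSet) : G.Dart := (Dart.toEdge_surjective e).choose

@[simp] theorem toEdge_edgeDart (e : G.edgeSet) : (edgeDart e).toEdge = e :=
  (Dart.toEdge_surjective e).choose_spec

theorem edgeDart_toEdge (d : G.Dart) :
    edgeDart d.toEdge = d ∨ edgeDart d.toEdge = d.symm :=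
  Dart.toEdge_eq_iff.1 (toEdge_edgeDart _)

instance [Finite V] : Finite G.Dart := Finite.of_injective _ Dart.toProd_injective

theorem sum_dart_eq_sum_edge [Fintype G.Dart] [Fintype G.edgeSet] {M : Type*} [AddCommMonoid M]
    (h : G.Dart → M) : ∑ d, h d = ∑ e : G.edgeSet, (h (edgeDart e) + h (edgeDart e).symm) := by
  classical
  rw [← Finset.sum_fiberwise Finset.univ Dart.toEdge]
  refine Finset.sum_congr rfl fun e _ => ?_
  have : Finset.univ.filter (fun d : G.Dart => d.toEdge = e)
      = {edgeDart e, (edgeDart e).symm} := by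
    ext d
    simp only [Finset.mem_filter, Finset.mem_univ, true_and, Finset.mem_insert,
      Finset.mem_singleton]
    rw [← Dart.toEdge_eq_iff, toEdge_edgeDart]
  rw [this, Finset.sum_pair (Dart.symm_ne _).symm]

/-- The edge set `z` (as a function to `ℤ/2`) has even degree at each vertex; stated by duality
with functions on the vertices. -/
def IsEvenChain [Fintype G.Dart] (z : G.edgeSet → ZMod 2) : Prop :=
  ∀ P : V → ZMod 2, ∑ d : G.Dart, P d.fst * z d.toEdge = 0

namespace EmbeddingScheme

variable (E : G.EmbeddingScheme)

theorem rot_inv_fst (d : G.Dart) : (E.rot⁻¹ d).fst = d.fst := by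
  rw [← E.fst_rot]; simp

theorem dartSign_symm (d : G.Dart) : E.dartSign d.symm = E.dartSign d := by
  unfold dartSign
  congr 1
  exact Subtype.ext d.edge_symm

/-- The other flag at the same corner. -/
def cornerFlip (x : G.Dart × ℤˣ) : G.Dart × ℤˣ :=
  ((E.rot ^ ((-x.2 : ℤˣ) : ℤ)) x.1, -x.2)

@[simp] theorem cornerFlip_neg_one (d : G.Dart) : E.cornerFlip (d, -1) = (E.rot d, 1) := by
  simp [cornerFlip]

@[simp] theorem cornerFlip_one (d : G.Dart) : E.cornerFlip (d, 1) = (E.rot⁻¹ d, -1) := by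
  simp [cornerFlip]

theorem cornerFlip_involutive : Function.Involutive E.cornerFlip := by
  rintro ⟨d, ε⟩
  rcases Int.units_eq_one_or ε with rfl | rfl <;> simp

theorem cornerFlip_fst (x : G.Dart × ℤˣ) : (E.cornerFlip x).1.fst = x.1.fst := by
  obtain ⟨d, ε⟩ := x
  rcases Int.units_eq_one_or ε with rfl | rfl
  · rw [cornerFlip_one, rot_inv_fst]
  · rw [cornerFlip_neg_one, fst_rot]

theorem faceReverse_involutive : Function.Involutive E.faceReverse := by
  rintro ⟨d, ε⟩
  simp [faceReverse, dartSign_symm, mul_assoc]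

/-- Face tracing alternates two involutions: slide along a side of an edge, then turn at a corner.
Being constant on faces thus means invariance under both. -/
theorem faceStep_eq (x : G.Dart × ℤˣ) : E.faceStep x = E.cornerFlip (E.faceReverse x) := by
  simp [faceStep, faceReverse, cornerFlip]

theorem cornerFlip_eq (x : G.Dart × ℤˣ) : E.cornerFlip x = E.faceStep (E.faceReverse x) := by
  rw [faceStep_eq, E.faceReverse_involutive]

/-- The facial walk of a flag. -/
def facialWalk (x : G.Dart × ℤˣ) : E.FacialWalk :=
  Quot.mk (fun x y => y = E.faceStep x ∨ y = E.faceReverse x) x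

theorem facialWalk_faceReverse (x : G.Dart × ℤˣ) :
    E.facialWalk (E.faceReverse x) = E.facialWalk x :=
  (Quot.sound (r := fun x y => y = E.faceStep x ∨ y = E.faceReverse x) (Or.inr rfl)).symm

theorem facialWalk_cornerFlip (x : G.Dart × ℤˣ) :
    E.facialWalk (E.cornerFlip x) = E.facialWalk x := by
  rw [cornerFlip_eq, ← E.facialWalk_faceReverse x]
  exact (Quot.sound (r := fun x y => y = E.faceStep x ∨ y = E.faceReverse x) (Or.inl rfl)).symm

/-- A function on the flags that is constant along each face. -/
def IsFaceFunction (φ : G.Dart × ℤˣ → ZMod 2) : Prop :=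
  (∀ x, φ (E.cornerFlip x) = φ x) ∧ ∀ x, φ (E.faceReverse x) = φ x

/-- The face function as a function on the facial walks. -/
def IsFaceFunction.lift {E : G.EmbeddingScheme} {φ : G.Dart × ℤˣ → ZMod 2}
    (h : E.IsFaceFunction φ) : E.FacialWalk → ZMod 2 :=
  Quot.lift φ (by
    rintro x y (rfl | rfl)
    · rw [faceStep_eq, h.1, h.2]
    · rw [h.2])

theorem isFaceFunction_comp (h : E.FacialWalk → ZMod 2) :
    E.IsFaceFunction (fun x => h (E.facialWalk x)) :=
  ⟨fun x => congrArg h (E.facialWalk_cornerFlip x),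
    fun x => congrArg h (E.facialWalk_faceReverse x)⟩

/-- An edge set that is the boundary modulo two of a set of faces. -/
def IsBoundary (z : G.edgeSet → ZMod 2) : Prop :=
  ∃ φ, E.IsFaceFunction φ ∧ ∀ d : G.Dart, z d.toEdge = φ (d, 1) + φ (d, -1)

/-- Crossing an edge at both of its ends gives the same difference. -/
theorem add_faceReverse (h : G.Dart × ℤˣ → ZMod 2) (d : G.Dart) :
    h (d.symm, 1) + h (d.symm, -1)
      = h (E.faceReverse (d, 1)) + h (E.faceReverse (d, -1)) := by
  rcases Int.units_eq_one_or (E.dartSign d) with hs | hs <;>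
    simp [faceReverse, hs, add_comm]

theorem add_symm_of_faceReverse {A : G.Dart × ℤˣ → ZMod 2} (hA : ∀ x, A (E.faceReverse x) = A x)
    (d : G.Dart) : A (d.symm, 1) + A (d.symm, -1) = A (d, 1) + A (d, -1) := by
  rw [E.add_faceReverse, hA, hA]

theorem sum_flag [Fintype G.Dart] (h : G.Dart × ℤˣ → ZMod 2) :
    ∑ x, h x = ∑ d, (h (d, 1) + h (d, -1)) := by
  rw [Fintype.sum_prod_type]
  refine Finset.sum_congr rfl fun d _ => ?_
  have : (Finset.univ : Finset ℤˣ) = {1, -1} := rfl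
  rw [this, Finset.sum_pair (by decide)]

theorem sum_flag_eq_sum_edge [Fintype G.Dart] [Fintype G.edgeSet] (h : G.Dart × ℤˣ → ZMod 2) :
    ∑ x, h x = ∑ e : G.edgeSet, ((h (edgeDart e, 1) + h (E.faceReverse (edgeDart e, 1)))
      + (h (edgeDart e, -1) + h (E.faceReverse (edgeDart e, -1)))) := by
  rw [sum_flag, sum_dart_eq_sum_edge]
  refine Finset.sum_congr rfl fun e _ => ?_
  rw [E.add_faceReverse]
  ring

/-- A cochain that vanishes on all boundaries has a primitive along the faces. -/
theorem exists_primitive [Fintype G.Dart] [Fintype G.edgeSet] (c : G.edgeSet → ZMod 2)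
    (hc : ∀ φ, E.IsFaceFunction φ →
      ∑ e, c e * (φ (edgeDart e, 1) + φ (edgeDart e, -1)) = 0) :
    ∃ p : G.Dart × ℤˣ → ZMod 2, (∀ x, p (E.cornerFlip x) = p x) ∧
      ∀ x, p x + p (E.faceReverse x) = c x.1.toEdge := by
  classical
  let P : Submodule (ZMod 2) (G.Dart × ℤˣ → ZMod 2) :=
    { carrier := {p | ∀ x, p (E.cornerFlip x) = p x}
      add_mem' := fun {p q} hp hq x => by simp [hp x, hq x]
      zero_mem' := fun x => rfl
      smul_mem' := fun a p hp x => by simp [hp x] }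
  let T : (G.Dart × ℤˣ → ZMod 2) →ₗ[ZMod 2] (G.Dart × ℤˣ → ZMod 2) :=
    { toFun := fun p x => p x + p (E.faceReverse x)
      map_add' := fun p q => by ext x; simp only [Pi.add_apply]; ring
      map_smul' := fun a p => by ext x; simp [mul_add] }
  -- Otherwise some functional, with coefficients `q`, kills the image of `P` under `T` but not `c`.
  -- Its symmetrization `r` turns out to be a face function, and the pairing of `c` with the
  -- boundary of `r` is the value of the functional at `c`.
  by_contra hcon
  have hnot : (fun x : G.Dart × ℤˣ => c x.1.toEdge) ∉ P.map T := by
    rintro ⟨p, hp, hpc⟩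
    exact hcon ⟨p, hp, fun x => congrFun hpc x⟩
  obtain ⟨f, hf0, hf⟩ := Submodule.exists_le_ker_of_notMem hnot
  apply hf0
  set q : G.Dart × ℤˣ → ZMod 2 := fun x => f (Pi.single x 1) with hq
  have hfq : ∀ y, f y = ∑ x, q x * y x := fun y => f.apply_eq_sum_single y
  set r : G.Dart × ℤˣ → ZMod 2 := fun x => q x + q (E.faceReverse x) with hr
  have hr1 : ∀ p ∈ P, ∑ x, p x * r x = 0 := by
    intro p hp
    rw [← sum_mul_add_comp_involutive E.faceReverse_involutive p q, ← hfq]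
    exact hf ⟨p, hp, rfl⟩
  have hface : E.IsFaceFunction r := by
    refine ⟨fun x => ?_, fun x => ?_⟩
    · have h := hr1 (Pi.single x 1 + Pi.single (E.cornerFlip x) 1) (by
        intro y
        have h1 : E.cornerFlip y = x ↔ y = E.cornerFlip x :=
          E.cornerFlip_involutive.eq_iff
        have h2 : E.cornerFlip y = E.cornerFlip x ↔ y = x :=
          E.cornerFlip_involutive.injective.eq_iff
        simp only [Pi.add_apply, Pi.single_apply, h1, h2]
        exact add_comm _ _)
      simp only [Pi.add_apply, add_mul, Finset.sum_add_distrib, Pi.single_apply, ite_mul, one_mul,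
        zero_mul, Finset.sum_ite_eq', Finset.mem_univ, if_true] at h
      rw [← CharTwo.add_eq_zero, add_comm, h]
    · simp only [hr]
      rw [E.faceReverse_involutive, add_comm]
  rw [hfq, E.sum_flag_eq_sum_edge, ← hc r hface]
  refine Finset.sum_congr rfl fun e _ => ?_
  simp only [faceReverse, Dart.toEdge_symm, toEdge_edgeDart, hr]
  ring

end EmbeddingScheme

end SimpleGraph

/-! ### Jumps and breadth-first forests -/

namespace SimpleGraph
namespace EmbeddingScheme

variable {V : Type*} {G : SimpleGraph V} (E : G.EmbeddingScheme)

/-- The corners of a set of faces; the dart `d` stands for the corner between `d` and `rot d`. -/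
abbrev FaceCorner (F : Set E.FacialWalk) : Type _ := {d : G.Dart // E.facialWalk (d, -1) ∈ F}

/-- The jumps of a function on the flags across the edges of `G` and across the corners
of the faces in `F`. -/
noncomputable def jump (F : Set E.FacialWalk) :
    (G.Dart × ℤˣ → ZMod 2) →ₗ[ZMod 2] (G.edgeSet ⊕ E.FaceCorner F → ZMod 2) where
  toFun p := Sum.elim (fun e => p (edgeDart e, 1) + p (edgeDart e, -1))
    (fun κ => p (κ.1, -1) + p (E.rot κ.1, 1))
  map_add' p q := by
    ext (e | κ) <;> simp only [Sum.elim_inl, Sum.elim_inr, Pi.add_apply] <;> ring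
  map_smul' a p := by
    ext (e | κ) <;> simp [mul_add]

/-- Incidence of vertices with edges and corners. -/
def Incident {F : Set E.FacialWalk} : G.edgeSet ⊕ E.FaceCorner F → V → Prop
  | Sum.inl e, v => v ∈ e.1
  | Sum.inr κ, v => κ.1.fst = v

/-- A breadth-first search forest of `G` that starts at the corners of the faces in `F`: each
vertex has a parent in the previous layer, the vertices in layer `0` are linked to a corner. -/
structure LayerForest (F : Set E.FacialWalk) where
  level : V → ℕ
  parent : V → V
  link : V → G.edgeSet ⊕ E.FaceCorner F
  level_le_of_adj : ∀ u v, G.Adj u v → level u ≤ level v + 1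
  level_corner : ∀ κ : E.FaceCorner F, level κ.1.fst = 0
  parent_of_level_eq_zero : ∀ v, level v = 0 → parent v = v
  link_of_level_eq_zero : ∀ v, level v = 0 → ∃ κ, link v = Sum.inr κ ∧ κ.1.fst = v
  level_of_level_ne_zero : ∀ v, level v ≠ 0 → level v = level (parent v) + 1
  link_of_level_ne_zero : ∀ v, level v ≠ 0 →
    ∃ d : G.Dart, d.fst = v ∧ d.snd = parent v ∧ link v = Sum.inl d.toEdge

variable {E} {F : Set E.FacialWalk}

theorem jump_toEdge {p : G.Dart × ℤˣ → ZMod 2}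
    (hsym : ∀ d : G.Dart, p (d.symm, 1) + p (d.symm, -1) = p (d, 1) + p (d, -1)) (d : G.Dart) :
    E.jump F p (Sum.inl d.toEdge) = p (d, 1) + p (d, -1) := by
  rcases edgeDart_toEdge d with h | h
  · simp [jump, h]
  · simp [jump, h, hsym]

/-- A turn around `v` crosses edges and corners alternately and ends where it began, so the jumps
telescope. -/
theorem sum_jump_eq_zero [Fintype G.Dart] [DecidableEq V] (p : G.Dart × ℤˣ → ZMod 2) (v : V) :
    ∑ d : G.Dart, (if d.fst = v then
      (p (d, 1) + p (d, -1)) + (p (d, -1) + p (E.rot d, 1)) else 0) = 0 := by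
  have h : ∑ d : G.Dart, (if d.fst = v then p (E.rot d, 1) else 0)
      = ∑ d : G.Dart, (if d.fst = v then p (d, 1) else 0) := by
    rw [← Equiv.sum_comp E.rot (fun d : G.Dart => if d.fst = v then p (d, 1) else 0)]
    simp [E.fst_rot]
  have h2 : ∀ d : G.Dart, (if d.fst = v then
      (p (d, 1) + p (d, -1)) + (p (d, -1) + p (E.rot d, 1)) else 0)
      = (if d.fst = v then p (d, 1) else 0) + (if d.fst = v then p (E.rot d, 1) else 0) := by
    intro d
    split_ifs
    · rw [add_assoc, ← add_assoc (p (d, -1)), CharTwo.add_self_eq_zero, zero_add]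
    · simp
  simp only [h2, Finset.sum_add_distrib, h]
  exact CharTwo.add_self_eq_zero _

/-- An edge cannot link both its ends, because levels drop towards the parent. Hence there are
exactly |V| links. -/
theorem LayerForest.link_injective (B : E.LayerForest F) : Function.Injective B.link := by
  intro u v huv
  by_cases hu : B.level u = 0 <;> by_cases hv : B.level v = 0
  · obtain ⟨κ, h1, h2⟩ := B.link_of_level_eq_zero u hu
    obtain ⟨κ', h1', h2'⟩ := B.link_of_level_eq_zero v hv
    rw [h1, h1', Sum.inr.injEq] at huv
    rw [← h2, ← h2', huv]
  · obtain ⟨κ, h1, h2⟩ := B.link_of_level_eq_zero u hu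
    obtain ⟨d, -, -, h1'⟩ := B.link_of_level_ne_zero v hv
    simp [h1, h1'] at huv
  · obtain ⟨κ, h1, h2⟩ := B.link_of_level_eq_zero v hv
    obtain ⟨d, -, -, h1'⟩ := B.link_of_level_ne_zero u hu
    simp [h1, h1'] at huv
  · obtain ⟨d, h1, h2, h3⟩ := B.link_of_level_ne_zero u hu
    obtain ⟨d', h1', h2', h3'⟩ := B.link_of_level_ne_zero v hv
    rw [h3, h3', Sum.inl.injEq, Dart.toEdge_eq_iff] at huv
    rcases huv with rfl | rfl
    · rw [← h1, ← h1']
    · have e1 : v = B.parent u := h1'.symm.trans h2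
      have e2 : B.parent v = u := h2'.symm.trans h1
      have := B.level_of_level_ne_zero u hu
      have := B.level_of_level_ne_zero v hv
      rw [e2] at this
      rw [← e1] at *
      omega

/-- If the jumps of `p` outside the forest occur only inside a set `L` that is closed under
parents, then `p` has no jumps at vertices outside `L`. -/
theorem LayerForest.eq_of_notMem [Finite V] [Finite G.Dart] (B : E.LayerForest F)
    {p : G.Dart × ℤˣ → ZMod 2}
    (hsym : ∀ d : G.Dart, p (d.symm, 1) + p (d.symm, -1) = p (d, 1) + p (d, -1))
    (hcorner : ∀ d : G.Dart, E.facialWalk (d, -1) ∉ F → p (d, -1) = p (E.rot d, 1))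
    {L : Set V} (hL : ∀ v ∈ L, B.parent v ∈ L)
    (hp : ∀ i ∉ Set.range B.link, ∀ v ∉ L, E.Incident i v → E.jump F p i = 0) (d : G.Dart)
    (hd : d.fst ∉ L) : p (d, 1) = p (d, -1) ∧ p (d, -1) = p (E.rot d, 1) := by
  classical
  have := Fintype.ofFinite G.Dart
  obtain ⟨N, hN⟩ := (Set.finite_range B.level).bddAbove
  replace hN : ∀ v, B.level v ≤ N := fun v => hN ⟨v, rfl⟩
  -- Induction from the deepest layer: at `v` only its own link can carry a jump, and the jumps
  -- around `v` sum to zero.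
  induction hn : N - B.level d.fst using Nat.strong_induction_on generalizing d with
  | _ n ih =>
  set v := d.fst with hv
  have hinl : ∀ d' : G.Dart, d'.fst = v → B.link v ≠ Sum.inl d'.toEdge →
      p (d', 1) + p (d', -1) = 0 := by
    intro d' hd' hne
    rw [← jump_toEdge (F := F) hsym d']
    by_cases hr : (Sum.inl d'.toEdge : G.edgeSet ⊕ E.FaceCorner F) ∈ Set.range B.link
    · obtain ⟨x, hx⟩ := hr
      have hx0 : B.level x ≠ 0 := by
        intro h0
        obtain ⟨κ, h1, -⟩ := B.link_of_level_eq_zero x h0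
        simp [h1] at hx
      obtain ⟨d1, h1, h2, h3⟩ := B.link_of_level_ne_zero x hx0
      have hlev := B.level_of_level_ne_zero x hx0
      rw [h3, Sum.inl.injEq, Dart.toEdge_eq_iff] at hx
      rcases hx with rfl | rfl
      · exact absurd (by rw [← hd', h1, h3]) hne
      · have e1 : B.parent x = v := h2.symm.trans hd'
        rw [e1] at hlev
        have hxL : x ∉ L := fun h => hd (e1 ▸ hL x h)
        have := ih (N - B.level x) (by have := hN x; omega) d'.symm (by rwa [h1]) (by rw [h1])
        rw [jump_toEdge hsym, ← hsym, this.1, CharTwo.add_self_eq_zero]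
    · refine hp _ hr v hd ?_
      rw [← hd']
      exact Sym2.mem_mk_left _ _
  have hinr : ∀ d' : G.Dart, d'.fst = v →
      (∀ h : E.facialWalk (d', -1) ∈ F, B.link v ≠ Sum.inr ⟨d', h⟩) →
      p (d', -1) + p (E.rot d', 1) = 0 := by
    intro d' hd' hne
    by_cases hF : E.facialWalk (d', -1) ∈ F
    · by_cases hr : (Sum.inr ⟨d', hF⟩ : G.edgeSet ⊕ E.FaceCorner F) ∈ Set.range B.link
      · obtain ⟨x, hx⟩ := hr
        have hx0 : B.level x = 0 := by
          by_contra h0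
          obtain ⟨d1, -, -, h1⟩ := B.link_of_level_ne_zero x h0
          simp [h1] at hx
        obtain ⟨κ, h1, h2⟩ := B.link_of_level_eq_zero x hx0
        have hκ := h1
        rw [hx, Sum.inr.injEq] at h1
        rw [← h1] at h2
        have : x = v := h2.symm.trans hd'
        exact absurd (this ▸ hx) (hne hF)
      · exact hp _ hr v hd hd'
    · rw [hcorner d' hF, CharTwo.add_self_eq_zero]
  have hsum := sum_jump_eq_zero (E := E) p v
  suffices h : p (d, 1) + p (d, -1) = 0 ∧ p (d, -1) + p (E.rot d, 1) = 0 from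
    ⟨CharTwo.add_eq_zero.1 h.1, CharTwo.add_eq_zero.1 h.2⟩
  by_cases h0 : B.level v = 0
  · obtain ⟨κ, h1, h2⟩ := B.link_of_level_eq_zero v h0
    have ha : ∀ d' : G.Dart, d'.fst = v → p (d', 1) + p (d', -1) = 0 :=
      fun d' hd' => hinl d' hd' (by simp [h1])
    have hb : ∀ d' : G.Dart, d'.fst = v → d' ≠ κ.1 → p (d', -1) + p (E.rot d', 1) = 0 := by
      refine fun d' hd' hne => hinr d' hd' fun h => ?_
      rw [h1, ne_eq, Sum.inr.injEq]
      rintro rfl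
      exact hne rfl
    refine ⟨ha d rfl, ?_⟩
    by_cases hdκ : d = κ.1
    · rw [Finset.sum_eq_single κ.1] at hsum
      · rw [if_pos h2, ha _ h2, zero_add] at hsum
        rw [hdκ, hsum]
      · intro d' _ hne
        split_ifs with h
        · rw [ha d' h, hb d' h hne, zero_add]
        · rfl
      · simp
    · exact hb d rfl hdκ
  · obtain ⟨d0, h1, h2, h3⟩ := B.link_of_level_ne_zero v h0
    have hlev := B.level_of_level_ne_zero v h0
    have ha : ∀ d' : G.Dart, d'.fst = v → d' ≠ d0 → p (d', 1) + p (d', -1) = 0 := by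
      refine fun d' hd' hne => hinl d' hd' ?_
      rw [h3, ne_eq, Sum.inl.injEq, Dart.toEdge_eq_iff]
      rintro (rfl | rfl)
      · exact hne rfl
      · have : v = B.parent v := hd'.symm.trans h2
        rw [← this] at hlev
        omega
    have hb : ∀ d' : G.Dart, d'.fst = v → p (d', -1) + p (E.rot d', 1) = 0 :=
      fun d' hd' => hinr d' hd' fun h => by simp [h3]
    refine ⟨?_, hb d rfl⟩
    by_cases hd0 : d = d0
    · rw [Finset.sum_eq_single d0] at hsum
      · rw [if_pos h1, hb _ h1, add_zero] at hsum
        rw [hd0, hsum]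
      · intro d' _ hne
        split_ifs with h
        · rw [hb d' h, ha d' h hne, zero_add]
        · rfl
      · simp
    · exact ha d rfl hd0

/-- A function without jumps around a vertex is constant there. -/
theorem eq_of_fst_eq [Finite G.Dart] {p : G.Dart × ℤˣ → ZMod 2} {v : V}
    (hv : ∀ d : G.Dart, d.fst = v → p (d, 1) = p (d, -1) ∧ p (d, -1) = p (E.rot d, 1))
    {x y : G.Dart × ℤˣ} (hx : x.1.fst = v) (hy : y.1.fst = v) : p x = p y := by
  have h1 : ∀ x : G.Dart × ℤˣ, x.1.fst = v → p x = p (x.1, 1) := by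
    rintro ⟨d, ε⟩ hd
    rcases Int.units_eq_one_or ε with rfl | rfl
    · rfl
    · exact (hv d hd).1.symm
  rw [h1 x hx, h1 y hy]
  obtain ⟨n, hn⟩ := (E.sameCycle_rot x.1 y.1 (hx.trans hy.symm)).exists_nat_pow_eq
  rw [← hn]
  have key : ∀ n : ℕ, ((E.rot ^ n) x.1).fst = v ∧ p (x.1, 1) = p ((E.rot ^ n) x.1, 1) := by
    intro n
    induction n with
    | zero => exact ⟨hx, rfl⟩
    | succ n ih =>
      rw [pow_succ', Equiv.Perm.mul_apply, E.fst_rot]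
      exact ⟨ih.1, ih.2.trans ((hv _ ih.1).1.trans (hv _ ih.1).2)⟩
  exact (key n).2

/-- A function on the flags without any jumps is constant. -/
theorem eq_of_connected [Finite G.Dart] (hG : G.Connected) {p : G.Dart × ℤˣ → ZMod 2}
    (hrev : ∀ x, p (E.faceReverse x) = p x)
    (hp : ∀ d : G.Dart, p (d, 1) = p (d, -1) ∧ p (d, -1) = p (E.rot d, 1))
    (x y : G.Dart × ℤˣ) : p x = p y := by
  have key : ∀ (u w : V) (q : G.Walk u w) (x y : G.Dart × ℤˣ), x.1.fst = u → y.1.fst = w →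
      p x = p y := by
    intro u w q
    induction q with
    | nil => exact fun x y hx hy => eq_of_fst_eq (E := E) (fun d _ => hp d) hx hy
    | @cons u v w h q ih =>
      intro x y hx hy
      rw [← ih (E.faceReverse (⟨(u, v), h⟩, 1)) y rfl hy, hrev]
      exact eq_of_fst_eq (E := E) (fun d _ => hp d) hx rfl
  obtain ⟨q⟩ := hG.preconnected x.1.fst y.1.fst
  exact key _ _ q x y rfl rfl

variable (E F) in
/-- Functions on the flags that are constant on each side of each edge and on
the faces outside `F`. -/
def relativeFaceFunctions : Submodule (ZMod 2) (G.Dart × ℤˣ → ZMod 2) where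
  carrier := {A | (∀ x, A (E.faceReverse x) = A x) ∧
    ∀ x, E.facialWalk x ∉ F → A (E.cornerFlip x) = A x}
  add_mem' := fun {a b} ha hb => ⟨fun x => by simp [ha.1 x, hb.1 x],
    fun x hx => by simp [ha.2 x hx, hb.2 x hx]⟩
  zero_mem' := ⟨fun _ => rfl, fun _ _ => rfl⟩
  smul_mem' := fun c a ha => ⟨fun x => by simp [ha.1 x], fun x hx => by simp [ha.2 x hx]⟩

/-- Outside `F` there is one free value per face. On the flags of `F` only invariance under an
involution is required, which leaves at least half the dimension, and each corner has two flags. -/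
theorem card_le_finrank_relativeFaceFunctions [Finite G.Dart] :
    Nat.card {q : E.FacialWalk // q ∉ F} + Nat.card (E.FaceCorner F)
      ≤ Module.finrank (ZMod 2) (E.relativeFaceFunctions F) := by
  classical
  have := Fintype.ofFinite G.Dart
  have : Finite E.FacialWalk := Quot.finite _
  have := Fintype.ofFinite E.FacialWalk
  have : Fintype (E.FaceCorner F) := Fintype.ofInjective
    (fun κ : E.FaceCorner F => κ.1) Subtype.val_injective
  let Ψ := {x : G.Dart × ℤˣ // E.facialWalk x ∈ F}
  let t : Ψ → Ψ := fun x => ⟨E.faceReverse x.1, by rw [facialWalk_faceReverse]; exact x.2⟩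
  have ht : ∀ x, t (t x) = x := fun x => Subtype.ext (E.faceReverse_involutive _)
  let T : (Ψ → ZMod 2) →ₗ[ZMod 2] (Ψ → ZMod 2) :=
    { toFun := fun p x => p x + p (t x)
      map_add' := fun p q => by ext x; simp only [Pi.add_apply]; ring
      map_smul' := fun a p => by ext x; simp [mul_add] }
  have hT : ∀ p, p ∈ LinearMap.ker T ↔ ∀ x, p (t x) = p x := by
    intro p
    rw [LinearMap.mem_ker, funext_iff]
    refine forall_congr' fun x => ?_
    change p x + p (t x) = 0 ↔ _
    rw [CharTwo.add_eq_zero, eq_comm]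
  have hker : Nat.card (E.FaceCorner F) ≤ Module.finrank (ZMod 2) (LinearMap.ker T) := by
    have h1 := T.finrank_range_add_finrank_ker
    have h2 : LinearMap.range T ≤ LinearMap.ker T := by
      rintro _ ⟨p, rfl⟩
      rw [hT]
      intro x
      change p (t x) + p (t (t x)) = p x + p (t x)
      rw [ht, add_comm]
    have h3 := Submodule.finrank_mono h2
    rw [Module.finrank_fintype_fun_eq_card] at h1
    have h4 : Fintype.card (E.FaceCorner F ⊕ E.FaceCorner F) ≤ Fintype.card Ψ := by
      refine Fintype.card_le_of_injective (Sum.elim (fun κ => ⟨(κ.1, -1), κ.2⟩)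
        (fun κ => ⟨(E.rot κ.1, 1), ?_⟩)) ?_
      · rw [← cornerFlip_neg_one, facialWalk_cornerFlip]
        exact κ.2
      · rintro (κ | κ) (κ' | κ') h
        · exact congrArg Sum.inl (Subtype.ext (congrArg (fun x : Ψ => x.1.1) h))
        · exact absurd (congrArg (fun x : Ψ => x.1.2) h) (by simp)
        · exact absurd (congrArg (fun x : Ψ => x.1.2) h) (by simp)
        · exact congrArg Sum.inr (Subtype.ext (E.rot.injective
            (congrArg (fun x : Ψ => x.1.1) h)))
    rw [Fintype.card_sum] at h4
    rw [Nat.card_eq_fintype_card]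
    omega
  let S : (({q : E.FacialWalk // q ∉ F} → ZMod 2) × LinearMap.ker T) →ₗ[ZMod 2]
      E.relativeFaceFunctions F :=
    { toFun := fun hk => ⟨fun x => if hx : E.facialWalk x ∈ F then hk.2.1 ⟨x, hx⟩
          else hk.1 ⟨E.facialWalk x, hx⟩, by
        refine ⟨fun x => ?_, fun x hx => ?_⟩
        · beta_reduce
          by_cases hx : E.facialWalk x ∈ F
          · rw [dif_pos hx, dif_pos (by rwa [facialWalk_faceReverse])]
            exact (hT _).1 hk.2.2 ⟨x, hx⟩
          · rw [dif_neg hx, dif_neg (by rwa [facialWalk_faceReverse])]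
            exact congrArg hk.1 (Subtype.ext (facialWalk_faceReverse _ _))
        · beta_reduce
          rw [dif_neg hx, dif_neg (by rwa [facialWalk_cornerFlip])]
          exact congrArg hk.1 (Subtype.ext (facialWalk_cornerFlip _ _))⟩
      map_add' := fun a b => by
        ext x
        by_cases hx : E.facialWalk x ∈ F <;> simp [hx]
      map_smul' := fun c a => by
        ext x
        by_cases hx : E.facialWalk x ∈ F <;> simp [hx] }
  have hS : Function.Injective S := by
    rw [← LinearMap.ker_eq_bot, LinearMap.ker_eq_bot']
    rintro ⟨h, k⟩ hk
    have hk' : ∀ x, (S (h, k)).1 x = 0 := fun x => by rw [hk]; rfl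
    refine Prod.ext (funext ?_) (Subtype.ext (funext ?_))
    · rintro ⟨q, hq⟩
      induction q using Quot.ind with
      | mk x =>
        have := hk' x
        rwa [show (S (h, k)).1 x = _ from dif_neg hq] at this
    · rintro ⟨x, hx⟩
      have := hk' x
      rwa [show (S (h, k)).1 x = _ from dif_pos hx] at this
  have h5 := LinearMap.finrank_le_finrank_of_injective hS
  rw [Module.finrank_prod, Module.finrank_fintype_fun_eq_card] at h5
  rw [Nat.card_eq_fintype_card (α := {q : E.FacialWalk // q ∉ F})]
  omega

/-- Up to faces, all jumps outside the forest can be moved to a small set `X`. -/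
theorem LayerForest.exists_finset_jump [Finite V] (hG : G.Connected) (B : E.LayerForest F) :
    ∃ X : Finset (G.edgeSet ⊕ E.FaceCorner F),
      X.card + Nat.card V + Nat.card {q : E.FacialWalk // q ∉ F} ≤ Nat.card G.edgeSet + 1 ∧
      ∀ p : G.Dart × ℤˣ → ZMod 2, ∃ A ∈ E.relativeFaceFunctions F,
        ∀ i ∉ Set.range B.link, i ∉ X → E.jump F (p + A) i = 0 := by
  classical
  have := Fintype.ofFinite V
  have := Fintype.ofFinite G.Dart
  have := Fintype.ofFinite G.edgeSet
  have : Fintype (E.FaceCorner F) := Fintype.ofInjective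
    (fun κ : E.FaceCorner F => κ.1) Subtype.val_injective
  let U := {i : G.edgeSet ⊕ E.FaceCorner F // i ∉ Set.range B.link}
  let R : E.relativeFaceFunctions F →ₗ[ZMod 2] (U → ZMod 2) :=
    (LinearMap.funLeft (ZMod 2) (ZMod 2) (Subtype.val : U → _)) ∘ₗ E.jump F ∘ₗ
      (E.relativeFaceFunctions F).subtype
  have hR : ∀ A (i : U), R A i = E.jump F A.1 i.1 := fun A i => rfl
  -- Without jumps off the forest there are none on it either (`L = ∅`), so by connectedness the
  -- function is constant.
  have hker : Module.finrank (ZMod 2) (LinearMap.ker R) ≤ 1 := by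
    rcases isEmpty_or_nonempty (G.Dart × ℤˣ) with hemp | ⟨⟨x₀⟩⟩
    · have : Subsingleton (LinearMap.ker R) := ⟨fun a b => by
        ext x
        exact hemp.elim x⟩
      rw [Module.finrank_zero_of_subsingleton]
      exact zero_le_one
    · let ev : LinearMap.ker R →ₗ[ZMod 2] ZMod 2 :=
        LinearMap.proj x₀ ∘ₗ (E.relativeFaceFunctions F).subtype ∘ₗ (LinearMap.ker R).subtype
      have hev : Function.Injective ev := by
        rw [← LinearMap.ker_eq_bot, LinearMap.ker_eq_bot']
        rintro ⟨⟨A, hA⟩, hRA⟩ h0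
        ext x
        change A x₀ = 0 at h0
        change A x = 0
        rw [← h0]
        refine eq_of_connected hG hA.1 (fun d => ?_) x x₀
        refine B.eq_of_notMem (L := ∅) (E.add_symm_of_faceReverse hA.1) (fun d hd => ?_) (by simp)
          (fun i hi _ _ _ => ?_) d (by simp)
        · rw [← hA.2 _ hd, cornerFlip_neg_one]
        · rw [LinearMap.mem_ker] at hRA
          exact congrFun hRA ⟨i, hi⟩
      have := LinearMap.finrank_le_finrank_of_injective hev
      rwa [Module.finrank_self] at this
  -- The size of `X` is the codimension of the range; the number of corners cancels in the count.
  obtain ⟨X, hX, hX2⟩ := (LinearMap.range R).exists_finset_forall_exists_mem_eq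
  refine ⟨X.image Subtype.val, ?_, fun p => ?_⟩
  · rw [Finset.card_image_of_injective _ Subtype.val_injective]
    have h1 := R.finrank_range_add_finrank_ker
    have h2 := card_le_finrank_relativeFaceFunctions (E := E) (F := F)
    have h3 : Fintype.card U + Fintype.card V
        = Fintype.card G.edgeSet + Fintype.card (E.FaceCorner F) := by
      have h := Fintype.card_subtype_compl
        (fun i : G.edgeSet ⊕ E.FaceCorner F => i ∈ Set.range B.link)
      have h' : Fintype.card {i // i ∈ Set.range B.link} = Fintype.card V :=
        Set.card_range_of_injective B.link_injective
      have h'' := Fintype.card_subtype_le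
        (fun i : G.edgeSet ⊕ E.FaceCorner F => i ∈ Set.range B.link)
      rw [Fintype.card_sum] at h h''
      have h4 : Fintype.card U =
        Fintype.card {i : G.edgeSet ⊕ E.FaceCorner F // ¬ i ∈ Set.range B.link} := rfl
      omega
    rw [Nat.card_eq_fintype_card (α := E.FaceCorner F)] at h2
    rw [Nat.card_eq_fintype_card (α := V), Nat.card_eq_fintype_card (α := G.edgeSet)]
    omega
  · obtain ⟨_, ⟨A, rfl⟩, hA⟩ := hX2 (fun i => E.jump F p i.1)
    refine ⟨A.1, A.2, fun i hi hiX => ?_⟩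
    have := hA ⟨i, hi⟩ (fun h => hiX (Finset.mem_image_of_mem _ h))
    rw [map_add, Pi.add_apply, ← hR A ⟨i, hi⟩, this]
    exact CharTwo.add_self_eq_zero _

/-- An even edge set that avoids the parent-closed set `L` around `X` is a boundary. -/
theorem LayerForest.isBoundary_of_isEvenChain [Finite V] [Fintype G.Dart] (B : E.LayerForest F)
    {X : Finset (G.edgeSet ⊕ E.FaceCorner F)}
    (hX : ∀ p : G.Dart × ℤˣ → ZMod 2, ∃ A ∈ E.relativeFaceFunctions F,
        ∀ i ∉ Set.range B.link, i ∉ X → E.jump F (p + A) i = 0)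
    {L : Set V} (hL : ∀ v ∈ L, B.parent v ∈ L) (hXL : ∀ i ∈ X, ∀ v, E.Incident i v → v ∈ L)
    {z : G.edgeSet → ZMod 2} (hz : IsEvenChain z) (hzL : ∀ d : G.Dart, d.fst ∈ L → z d.toEdge = 0) :
    E.IsBoundary z := by
  classical
  have := Fintype.ofFinite G.edgeSet
  let W : Submodule (ZMod 2) (G.edgeSet → ZMod 2) :=
    { carrier := {y | ∃ φ, E.IsFaceFunction φ ∧
        ∀ e, y e = φ (edgeDart e, 1) + φ (edgeDart e, -1)}
      add_mem' := by
        rintro _ _ ⟨φ, h1, h2⟩ ⟨ψ, h3, h4⟩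
        refine ⟨φ + ψ, ⟨fun x => by simp [h1.1 x, h3.1 x], fun x => by simp [h1.2 x, h3.2 x]⟩,
          fun e => ?_⟩
        simp only [Pi.add_apply, h2, h4]
        ring
      zero_mem' := ⟨0, ⟨fun _ => rfl, fun _ => rfl⟩, fun e => by simp⟩
      smul_mem' := by
        rintro c _ ⟨φ, h1, h2⟩
        exact ⟨c • φ, ⟨fun x => by simp [h1.1 x], fun x => by simp [h1.2 x]⟩,
          fun e => by simp [h2, mul_add]⟩ }
  by_cases hzW : z ∈ W
  · obtain ⟨φ, h1, h2⟩ := hzW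
    refine ⟨φ, h1, fun d => ?_⟩
    rw [h2]
    rcases edgeDart_toEdge d with h | h
    · rw [h]
    · rw [h, E.add_symm_of_faceReverse h1.2]
  exfalso
  -- The functional separates `z` from the boundaries; its primitive, corrected by `A`, shows that
  -- it is a coboundary away from `L`.
  obtain ⟨f, hfz, hf⟩ := Submodule.exists_le_ker_of_notMem hzW
  apply hfz
  set c : G.edgeSet → ZMod 2 := fun e => f (Pi.single e 1) with hc
  have hfc : ∀ y, f y = ∑ e, c e * y e := fun y => f.apply_eq_sum_single y
  obtain ⟨p, hp1, hp2⟩ := E.exists_primitive c (fun φ hφ => by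
    rw [← hfc (fun e => φ (edgeDart e, 1) + φ (edgeDart e, -1))]
    exact hf ⟨φ, hφ, fun e => rfl⟩)
  obtain ⟨A, hA, hA2⟩ := hX p
  set p' := p + A with hp'
  have hp2' : ∀ x, p' x + p' (E.faceReverse x) = c x.1.toEdge := by
    intro x
    simp only [hp', Pi.add_apply, hA.1]
    rw [add_add_add_comm, hp2, CharTwo.add_self_eq_zero, add_zero]
  have hsym : ∀ d : G.Dart, p' (d.symm, 1) + p' (d.symm, -1) = p' (d, 1) + p' (d, -1) := by
    intro d
    rw [E.add_faceReverse, ← CharTwo.add_eq_zero]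
    have h1 := hp2' (d, 1)
    have h2 := hp2' (d, -1)
    calc _ = (p' (d, 1) + p' (E.faceReverse (d, 1))) +
          (p' (d, -1) + p' (E.faceReverse (d, -1))) := by ring
      _ = 0 := by rw [h1, h2]; exact CharTwo.add_self_eq_zero _
  have hcorner : ∀ d : G.Dart, E.facialWalk (d, -1) ∉ F → p' (d, -1) = p' (E.rot d, 1) := by
    intro d hd
    simp only [hp', Pi.add_apply]
    rw [← cornerFlip_neg_one, hp1, hA.2 _ hd]
  have hconst := fun d => B.eq_of_notMem hsym hcorner hL (fun i hi v hv hiv =>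
    hA2 i hi fun hiX => hv (hXL i hiX v hiv)) d
  -- The default value is irrelevant, as all sums run over darts; on `L` the choice of dart is
  -- harmless because `z` vanishes there.
  let P : V → ZMod 2 := fun v => if h : ∃ d : G.Dart, d.fst = v then p' (h.choose, 1) else 0
  have hP : ∀ x : G.Dart × ℤˣ, x.1.fst ∉ L → p' x = P x.1.fst := by
    intro x hx
    have h : ∃ d : G.Dart, d.fst = x.1.fst := ⟨x.1, rfl⟩
    simp only [P, dif_pos h]
    exact eq_of_fst_eq (E := E) (v := x.1.fst) (fun d hd => hconst d (by rwa [hd])) rfl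
      h.choose_spec
  rw [hfc, ← hz P, sum_dart_eq_sum_edge]
  refine Finset.sum_congr rfl fun e _ => ?_
  rw [Dart.toEdge_symm, toEdge_edgeDart, ← add_mul]
  by_cases h1 : (edgeDart e).fst ∈ L
  · have := hzL _ h1
    rw [toEdge_edgeDart] at this
    simp [this]
  by_cases h2 : (edgeDart e).symm.fst ∈ L
  · have := hzL _ h2
    rw [Dart.toEdge_symm, toEdge_edgeDart] at this
    simp [this]
  congr 1
  have := hp2' (edgeDart e, 1)
  rw [toEdge_edgeDart] at this
  rw [← this, hP _ h1, hP]
  · rfl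
  · exact h2

end EmbeddingScheme
end SimpleGraph

/-! ### Vertical sets meeting all cycles that do not bound -/

namespace SimpleGraph
namespace EmbeddingScheme

variable {V : Type*} {G : SimpleGraph V} {E : G.EmbeddingScheme} {F : Set E.FacialWalk}

theorem exists_faceCorner_of_facialWalk_mem {x : G.Dart × ℤˣ} (hx : E.facialWalk x ∈ F) :
    ∃ κ : E.FaceCorner F, κ.1.fst = x.1.fst := by
  obtain ⟨d, ε⟩ := x
  rcases Int.units_eq_one_or ε with rfl | rfl
  · refine ⟨⟨E.rot⁻¹ d, ?_⟩, E.rot_inv_fst d⟩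
    rwa [← cornerFlip_one, facialWalk_cornerFlip]
  · exact ⟨⟨d, hx⟩, rfl⟩

/-- The level is the distance to the vertices with a corner in `F`; the next vertex on a shortest
walk is the parent. -/
theorem nonempty_layerForest (hG : G.Connected) (hF : F.Nonempty) :
    Nonempty (E.LayerForest F) := by
  classical
  let S : Set V := {v | ∃ κ : E.FaceCorner F, κ.1.fst = v}
  obtain ⟨s₀, hs₀⟩ : S.Nonempty := by
    obtain ⟨q, hq⟩ := hF
    induction q using Quot.ind with
    | mk x =>
      obtain ⟨κ, hκ⟩ := exists_faceCorner_of_facialWalk_mem (x := x) hq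
      exact ⟨_, κ, rfl⟩
  let level : V → ℕ := fun v => sInf {n | ∃ s ∈ S, G.dist v s = n}
  have hatt : ∀ v, ∃ s ∈ S, G.dist v s = level v := fun v =>
    Nat.sInf_mem (s := {n | ∃ s ∈ S, G.dist v s = n}) ⟨_, s₀, hs₀, rfl⟩
  have hle : ∀ v, ∀ s ∈ S, level v ≤ G.dist v s := fun v s hs => Nat.sInf_le ⟨s, hs, rfl⟩
  have hadj : ∀ u v, G.Adj u v → level u ≤ level v + 1 := by
    intro u v huv
    obtain ⟨s, hs, hd⟩ := hatt v
    have h1 := hle u s hs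
    have h2 := hG.dist_triangle (u := u) (v := v) (w := s)
    rw [dist_eq_one_iff_adj.2 huv] at h2
    omega
  have hzero : ∀ v, level v = 0 → v ∈ S := by
    intro v hv
    obtain ⟨s, hs, hd⟩ := hatt v
    rw [hv, hG.dist_eq_zero_iff] at hd
    rwa [hd]
  have hpar : ∀ v, level v ≠ 0 → ∃ u, G.Adj v u ∧ level v = level u + 1 := by
    intro v hv
    obtain ⟨s, hs, hd⟩ := hatt v
    obtain ⟨p, hp⟩ := hG.exists_walk_length_eq_dist v s
    cases p with
    | nil => simp at hd; omega
    | @cons _ u _ h q =>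
      refine ⟨u, h, ?_⟩
      have h1 := hle u s hs
      have h2 := dist_le q
      have h3 := hadj v u h
      rw [Walk.length_cons] at hp
      omega
  choose! par hpar1 hpar2 using hpar
  have : Nonempty (E.FaceCorner F) := ⟨hs₀.choose⟩
  choose! cor hcor using hzero
  refine ⟨{
    level := level
    parent := fun v => if level v = 0 then v else par v
    link := fun v => if h : level v = 0 then Sum.inr (cor v) else
      Sum.inl (Dart.toEdge ⟨(v, par v), hpar1 v h⟩)
    level_le_of_adj := hadj
    level_corner := fun κ => ?_
    parent_of_level_eq_zero := fun v h => if_pos h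
    link_of_level_eq_zero := fun v h => ⟨cor v, dif_pos h, hcor v h⟩
    level_of_level_ne_zero := fun v h => ?_
    link_of_level_ne_zero := fun v h => ⟨⟨(v, par v), hpar1 v h⟩, rfl, ?_, dif_neg h⟩ }⟩
  · have := hle κ.1.fst κ.1.fst ⟨κ, rfl⟩
    simpa using this
  · rw [if_neg h]
    exact hpar2 v h
  · rw [if_neg h]

/-- Truncated subtraction fits the convention that vertices of layer 0 are their own parents. -/
theorem LayerForest.level_iterate_parent (B : E.LayerForest F) (v : V) (n : ℕ) :
    B.level (B.parent^[n] v) = B.level v - n := by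
  induction n with
  | zero => rfl
  | succ n ih =>
    rw [Function.iterate_succ_apply']
    by_cases h : B.level (B.parent^[n] v) = 0
    · rw [B.parent_of_level_eq_zero _ h]
      omega
    · have := B.level_of_level_ne_zero _ h
      omega

theorem LayerForest.iterate_parent_eq (B : E.LayerForest F) (v : V) {n : ℕ}
    (hn : B.level v ≤ n) : B.parent^[n] v = B.parent^[B.level v] v := by
  induction n, hn using Nat.le_induction with
  | base => rfl
  | succ n hn ih =>
    rw [Function.iterate_succ_apply', B.parent_of_level_eq_zero, ih]
    rw [level_iterate_parent]
    omega

/-- In an embedded graph of Euler genus `g` with breadth-first search layers around a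
set of faces `F`, few vertical paths suffice to hit all essential even subgraphs. -/
theorem exists_vertical_set [Finite V] [Fintype G.Dart] (hG : G.Connected) {g : ℕ}
    (hg : E.eulerGenus = g) (hF : F.Nonempty) :
    ∃ (L : Set V) (level : V → ℕ), (∀ u v, G.Adj u v → level u ≤ level v + 1) ∧
      (∀ q ∈ F, ∀ v ∈ E.boundary (Sum.inl q), level v = 0) ∧
      (∀ n, (L ∩ {v | level v = n}).ncard ≤ 2 * (g + F.ncard - 1)) ∧
      ∀ z : G.edgeSet → ZMod 2, IsEvenChain z → (∀ d : G.Dart, d.fst ∈ L → z d.toEdge = 0) →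
        E.IsBoundary z := by
  classical
  obtain ⟨B⟩ := nonempty_layerForest hG hF
  obtain ⟨X, hXcard, hX⟩ := B.exists_finset_jump hG
  have : Finite E.FacialWalk := Quot.finite _
  -- Euler's formula. A facial walk contains a dart, so there are no isolated vertices and all faces
  -- are facial walks.
  have hXg : X.card ≤ g + F.ncard - 1 := by
    have hiso : IsEmpty {v : V // ∀ w, ¬ G.Adj v w} := by
      refine ⟨fun v => ?_⟩
      obtain ⟨q, -⟩ := hF
      induction q using Quot.ind with
      | mk x =>
        have : Nontrivial V := ⟨_, _, x.1.adj.ne⟩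
        obtain ⟨w, hw⟩ := hG.preconnected.exists_adj_of_nontrivial v.1
        exact v.2 w hw
    have h1 : Nat.card G.ConnectedComponent = 1 := by
      have := hG.nonempty
      have := hG.preconnected.subsingleton_connectedComponent
      exact Nat.card_of_subsingleton (G.connectedComponentMk (Classical.arbitrary V))
    have h2 : Nat.card E.Face = Nat.card E.FacialWalk := by
      rw [Face, Nat.card_sum, Nat.card_of_isEmpty (α := {v : V // ∀ w, ¬ G.Adj v w}), add_zero]
    have h3 : Nat.card {q : E.FacialWalk // q ∉ F} + F.ncard = Nat.card E.FacialWalk := by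
      have := Set.ncard_compl_add_ncard F
      exact this
    unfold eulerGenus at hg
    rw [h1, h2] at hg
    omega
  let ends : G.edgeSet ⊕ E.FaceCorner F → Finset V := Sum.elim
    (fun e => {(edgeDart e).fst, (edgeDart e).snd}) (fun κ => {κ.1.fst})
  have hends : ∀ i v, E.Incident i v → v ∈ ends i := by
    rintro (e | κ) v h
    · have he : e.1 = s((edgeDart e).fst, (edgeDart e).snd) := by
        rw [← congrArg Subtype.val (toEdge_edgeDart e)]
        simp [Dart.toEdge, Dart.edge]
      simp only [Incident] at h
      rw [he, Sym2.mem_iff] at h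
      simpa [ends] using h
    · have h' : κ.1.fst = v := h
      simp [ends, h']
  have hends2 : (X.biUnion ends).card ≤ 2 * (g + F.ncard - 1) := by
    refine (Finset.card_biUnion_le_card_mul X ends 2 ?_).trans (by omega)
    rintro (e | κ) -
    · exact Finset.card_le_two
    · simp [ends]
  let L : Set V := {v | ∃ u ∈ X.biUnion ends, ∃ n, B.parent^[n] u = v}
  refine ⟨L, B.level, B.level_le_of_adj, ?_, fun n => ?_, ?_⟩
  · rintro q hq v ⟨x, rfl, rfl⟩
    obtain ⟨κ, hκ⟩ := exists_faceCorner_of_facialWalk_mem (x := x) hq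
    rw [← hκ]
    exact B.level_corner κ
  · have hsub : L ∩ {v | B.level v = n} ⊆
        ((X.biUnion ends).image fun u => B.parent^[B.level u - n] u : Finset V) := by
      rintro v ⟨⟨u, hu, k, rfl⟩, hv⟩
      rw [Finset.mem_coe, Finset.mem_image]
      refine ⟨u, hu, ?_⟩
      have hv' : B.level (B.parent^[k] u) = n := hv
      rw [B.level_iterate_parent] at hv'
      rcases le_total (B.level u) k with hk | hk
      · rw [B.iterate_parent_eq u hk]
        congr 1
        omega
      · congr 1
        omega
    calc _ ≤ _ := Set.ncard_le_ncard hsub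
      _ ≤ _ := by rw [Set.ncard_coe_finset]; exact Finset.card_image_le.trans hends2
  · intro z hz hzL
    refine B.isBoundary_of_isEvenChain hX (L := L) ?_ ?_ hz hzL
    · rintro v ⟨u, hu, n, rfl⟩
      exact ⟨u, hu, n + 1, Function.iterate_succ_apply' _ _ _⟩
    · exact fun i hi v hv => ⟨v, Finset.mem_biUnion.2 ⟨i, hi, hends i v hv⟩, 0, rfl⟩

end EmbeddingScheme
end SimpleGraph

/-! ### Euler genus zero and planarity of subgraphs -/

/-- The first return map of a permutation `π` of a finite set to a subset. -/
theorem Equiv.Perm.exists_firstReturn {α β : Type*} [Finite α] (π : Equiv.Perm α) {i : β → α}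
    (hi : Function.Injective i) :
    ∃ π' : Equiv.Perm β, (∀ b, ∃ k, i (π' b) = (π ^ (k + 1)) (i b) ∧
      ∀ j < k, (π ^ (j + 1)) (i b) ∉ Set.range i) ∧
      ∀ b b', π.SameCycle (i b) (i b') → π'.SameCycle b b' := by
  classical
  have : Finite β := Finite.of_injective i hi
  have hex : ∀ b, ∃ k, (π ^ (k + 1)) (i b) ∈ Set.range i := by
    intro b
    refine ⟨orderOf π - 1, b, ?_⟩
    rw [Nat.sub_add_cancel (orderOf_pos π), pow_orderOf_eq_one]
    rfl
  choose next hnext using fun b => Nat.find_spec (hex b)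
  have hmin : ∀ b, ∀ j < Nat.find (hex b), (π ^ (j + 1)) (i b) ∉ Set.range i :=
    fun b j hj => Nat.find_min (hex b) hj
  have hinj : Function.Injective next := by
    -- Cancelling the shorter run shows that the longer one meets `i a` before its end, against
    -- minimality, unless the runs are equally long.
    have key : ∀ a b, next a = next b → Nat.find (hex a) ≤ Nat.find (hex b) → a = b := by
      intro a b hab hle
      have h := hnext a
      rw [hab, hnext b, show Nat.find (hex b) + 1 = (Nat.find (hex a) + 1) +
        (Nat.find (hex b) - Nat.find (hex a)) by omega, pow_add, Equiv.Perm.mul_apply] at h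
      replace h := (π ^ (Nat.find (hex a) + 1)).injective h
      rcases Nat.eq_zero_or_pos (Nat.find (hex b) - Nat.find (hex a)) with h0 | h0
      · rw [h0] at h
        exact (hi h).symm
      · refine absurd ⟨a, ?_⟩ (hmin b (Nat.find (hex b) - Nat.find (hex a) - 1) (by omega))
        rw [Nat.sub_add_cancel h0, h]
    intro a b hab
    rcases le_total (Nat.find (hex a)) (Nat.find (hex b)) with h | h
    · exact key a b hab h
    · exact (key b a hab.symm h).symm
  refine ⟨Equiv.ofBijective next (Finite.injective_iff_bijective.1 hinj),
    fun b => ⟨_, hnext b, hmin b⟩, fun b b' hbb => ?_⟩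
  obtain ⟨n, hn⟩ := hbb.exists_nat_pow_eq
  clear hbb
  induction n using Nat.strong_induction_on generalizing b with
  | _ n ih =>
  rcases Nat.eq_zero_or_pos n with rfl | hpos
  · rw [hi hn]
  · have hle : Nat.find (hex b) + 1 ≤ n := by
      by_contra hlt
      refine hmin b (n - 1) (by omega) ⟨b', ?_⟩
      rw [Nat.sub_add_cancel hpos, hn]
    rw [show n = (n - (Nat.find (hex b) + 1)) + (Nat.find (hex b) + 1) by omega, pow_add,
      Equiv.Perm.mul_apply, ← hnext b] at hn
    have := ih _ (by omega) (next b) hn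
    rwa [← Equiv.Perm.sameCycle_apply_left]

namespace SimpleGraph
namespace EmbeddingScheme

section Genus

variable {V : Type*} {G : SimpleGraph V} (E : G.EmbeddingScheme)

/-- Each corner joins two flags at the same vertex with equal values, so the contributions cancel in
pairs. -/
theorem IsBoundary.isEvenChain [Fintype G.Dart] {E : G.EmbeddingScheme}
    {z : G.edgeSet → ZMod 2} (hz : E.IsBoundary z) : IsEvenChain z := by
  obtain ⟨φ, hφ, hzφ⟩ := hz
  intro P
  have h : ∀ d : G.Dart, φ (d, -1) = φ (E.rot d, 1) := by
    intro d
    rw [← cornerFlip_neg_one, hφ.1]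
  simp only [hzφ, h, mul_add, Finset.sum_add_distrib]
  rw [← Equiv.sum_comp E.rot (fun d : G.Dart => P d.fst * φ (d, 1))]
  simp only [E.fst_rot]
  exact CharTwo.add_self_eq_zero _

/-- The functions on the vertices that are constant on each component. -/
def componentFunctions (G : SimpleGraph V) : Submodule (ZMod 2) (V → ZMod 2) where
  carrier := {P | ∀ u v, G.Adj u v → P u = P v}
  add_mem' := fun {a b} ha hb u v h => by simp [ha u v h, hb u v h]
  zero_mem' := fun _ _ _ => rfl
  smul_mem' := fun c a ha u v h => by simp [ha u v h]

theorem finrank_componentFunctions [Finite V] :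
    Module.finrank (ZMod 2) (componentFunctions G) = Nat.card G.ConnectedComponent := by
  classical
  have := Fintype.ofFinite G.ConnectedComponent
  let a : (G.ConnectedComponent → ZMod 2) →ₗ[ZMod 2] componentFunctions G :=
    { toFun := fun h => ⟨fun v => h (G.connectedComponentMk v), fun u v huv =>
        congrArg h (ConnectedComponent.sound huv.reachable)⟩
      map_add' := fun _ _ => rfl
      map_smul' := fun _ _ => rfl }
  have ha : Function.Bijective a := by
    constructor
    · intro h h' hh
      ext c
      induction c using ConnectedComponent.ind with
      | h v => exact congrFun (congrArg Subtype.val hh) v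
    · rintro ⟨P, hP⟩
      have hwalk : ∀ u v, G.Walk u v → P u = P v := by
        intro u v p
        induction p with
        | nil => rfl
        | cons h _ ih => exact (hP _ _ h).trans ih
      exact ⟨ConnectedComponent.lift P fun u v p _ => hwalk u v p, rfl⟩
  rw [← (LinearEquiv.ofBijective a ha).finrank_eq, Module.finrank_fintype_fun_eq_card,
    Nat.card_eq_fintype_card]

/-- The boundary map of the faces. -/
noncomputable def faceBoundary : (E.FacialWalk ⊕ {v : V // ∀ w, ¬ G.Adj v w} → ZMod 2) →ₗ[ZMod 2] (G.edgeSet → ZMod 2) where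
  toFun h e := h (Sum.inl (E.facialWalk (edgeDart e, 1))) +
    h (Sum.inl (E.facialWalk (edgeDart e, -1)))
  map_add' p q := by
    ext e
    simp only [Pi.add_apply]
    ring
  map_smul' a p := by
    ext e
    simp [mul_add]

variable {E} in
theorem faceBoundary_toEdge (h : E.FacialWalk ⊕ {v : V // ∀ w, ¬ G.Adj v w} → ZMod 2) (d : G.Dart) :
    E.faceBoundary h d.toEdge = h (Sum.inl (E.facialWalk (d, 1))) +
      h (Sum.inl (E.facialWalk (d, -1))) := by
  rcases edgeDart_toEdge d with hd | hd
  · simp [faceBoundary, hd]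
  · have h1 := E.add_symm_of_faceReverse (A := fun x => h (Sum.inl (E.facialWalk x)))
      (E.isFaceFunction_comp fun q => h (Sum.inl q)).2 d
    beta_reduce at h1
    rw [← h1, ← hd]
    rfl

theorem isBoundary_faceBoundary (h : E.FacialWalk ⊕ {v : V // ∀ w, ¬ G.Adj v w} → ZMod 2) : E.IsBoundary (E.faceBoundary h) :=
  ⟨_, E.isFaceFunction_comp fun q => h (Sum.inl q), fun d => faceBoundary_toEdge h d⟩

variable {E} in
theorem IsBoundary.mem_range {z : G.edgeSet → ZMod 2} (hz : E.IsBoundary z) :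
    z ∈ LinearMap.range E.faceBoundary := by
  obtain ⟨φ, hφ, hzφ⟩ := hz
  refine ⟨Sum.elim hφ.lift 0, ?_⟩
  ext e
  have := hzφ (edgeDart e)
  rw [toEdge_edgeDart] at this
  rw [this]
  rfl

/-- A set of faces with zero boundary is a union of full components, as its indicator is constant
around vertices and along edges. The extra faces account for the isolated vertices. -/
theorem finrank_ker_faceBoundary [Finite V] :
    Module.finrank (ZMod 2) (LinearMap.ker E.faceBoundary) = Nat.card G.ConnectedComponent := by
  classical
  have hK : ∀ P ∈ componentFunctions G, E.IsFaceFunction (fun x => P x.1.fst) := by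
    refine fun P hP => ⟨fun x => ?_, fun x => ?_⟩
    · exact congrArg P (E.cornerFlip_fst x)
    · exact (hP _ _ x.1.adj).symm
  let b : componentFunctions G →ₗ[ZMod 2] LinearMap.ker E.faceBoundary :=
    { toFun := fun P => ⟨Sum.elim (hK P.1 P.2).lift (fun v => P.1 v.1), by
        rw [LinearMap.mem_ker]
        ext e
        exact CharTwo.add_self_eq_zero _⟩
      map_add' := by
        rintro ⟨P, hP⟩ ⟨Q, hQ⟩
        ext (q | v)
        · induction q using Quot.ind
          rfl
        · rfl
      map_smul' := by
        rintro c ⟨P, hP⟩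
        ext (q | v)
        · induction q using Quot.ind
          rfl
        · rfl }
  have hb : Function.Bijective b := by
    constructor
    · rintro ⟨P, hP⟩ ⟨Q, hQ⟩ hPQ
      ext v
      have h := fun f => congrFun (congrArg Subtype.val hPQ) f
      by_cases hv : ∀ w, ¬ G.Adj v w
      · exact h (Sum.inr ⟨v, hv⟩)
      · push Not at hv
        obtain ⟨w, hw⟩ := hv
        exact h (Sum.inl (E.facialWalk (⟨(v, w), hw⟩, 1)))
    · rintro ⟨h, hh⟩
      rw [LinearMap.mem_ker] at hh
      set φ : G.Dart × ℤˣ → ZMod 2 := fun x => h (Sum.inl (E.facialWalk x)) with hφ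
      have hface : E.IsFaceFunction φ := E.isFaceFunction_comp fun q => h (Sum.inl q)
      have hloc : ∀ d : G.Dart, φ (d, 1) = φ (d, -1) ∧ φ (d, -1) = φ (E.rot d, 1) := by
        intro d
        refine ⟨?_, ?_⟩
        · rw [← CharTwo.add_eq_zero, hφ, ← faceBoundary_toEdge, hh]
          rfl
        · rw [← cornerFlip_neg_one, hface.1]
      have hfst : ∀ x y : G.Dart × ℤˣ, x.1.fst = y.1.fst → φ x = φ y := fun x y hxy =>
        eq_of_fst_eq (E := E) (fun d _ => hloc d) hxy rfl
      let P : V → ZMod 2 := fun v => if hv : ∃ d : G.Dart, d.fst = v then φ (hv.choose, 1)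
        else if hv : ∀ w, ¬ G.Adj v w then h (Sum.inr ⟨v, hv⟩) else 0
      have hP : ∀ x : G.Dart × ℤˣ, P x.1.fst = φ x := by
        intro x
        have hx : ∃ d : G.Dart, d.fst = x.1.fst := ⟨x.1, rfl⟩
        simp only [P, dif_pos hx]
        exact hfst _ _ hx.choose_spec
      refine ⟨⟨P, fun u v huv => ?_⟩, ?_⟩
      · have h1 := hP (⟨(u, v), huv⟩, 1)
        have h2 := hP (E.faceReverse (⟨(u, v), huv⟩, 1))
        rw [hface.2] at h2
        exact h1.trans h2.symm
      · ext (q | v)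
        · induction q using Quot.ind with
          | mk x => exact hP x
        · change P v.1 = _
          have h1 : ¬ ∃ d : G.Dart, d.fst = v.1 := by
            rintro ⟨d, hd⟩
            exact v.2 d.snd (hd ▸ d.adj)
          simp only [P, dif_neg h1, dif_pos v.2]
  rw [← (LinearEquiv.ofBijective b hb).finrank_eq, finrank_componentFunctions]

/-- The incidence matrix modulo two. -/
noncomputable def incidence (G : SimpleGraph V) [DecidableEq V] :
    Matrix V G.edgeSet (ZMod 2) :=
  Matrix.of fun v e => (if (edgeDart e).fst = v then 1 else 0) +
    (if (edgeDart e).snd = v then 1 else 0)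

theorem transpose_incidence_mulVec [Fintype V] [DecidableEq V] (P : V → ZMod 2) (e : G.edgeSet) :
    ((incidence G).transpose.mulVec P) e = P (edgeDart e).fst + P (edgeDart e).snd := by
  simp [incidence, Matrix.mulVec, dotProduct, add_mul, Finset.sum_add_distrib]

theorem isEvenChain_iff [Fintype V] [DecidableEq V] [Fintype G.Dart] [Fintype G.edgeSet]
    (z : G.edgeSet → ZMod 2) : IsEvenChain z ↔ (incidence G).mulVec z = 0 := by
  have key : ∀ P : V → ZMod 2, ∑ d : G.Dart, P d.fst * z d.toEdge
      = P ⬝ᵥ ((incidence G).mulVec z) := by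
    intro P
    rw [Matrix.dotProduct_mulVec, ← Matrix.mulVec_transpose, dotProduct, sum_dart_eq_sum_edge]
    refine Finset.sum_congr rfl fun e _ => ?_
    rw [transpose_incidence_mulVec, add_mul, Dart.toEdge_symm, toEdge_edgeDart]
    rfl
  constructor
  · intro h
    refine dotProduct_eq_zero _ fun P => ?_
    rw [dotProduct_comm, ← key]
    exact h P
  · intro h P
    rw [key, h, dotProduct_zero]

/-- An embedding in which all even edge sets are boundaries has Euler genus zero. -/
theorem eulerGenus_eq_zero [Finite V] [Fintype G.Dart]
    (h : ∀ z : G.edgeSet → ZMod 2, IsEvenChain z → E.IsBoundary z) : E.eulerGenus = 0 := by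
  classical
  have := Fintype.ofFinite V
  have := Fintype.ofFinite G.edgeSet
  have : Finite E.FacialWalk := Quot.finite _
  have := Fintype.ofFinite E.FacialWalk
  set M := incidence G with hM
  have h1 : LinearMap.range E.faceBoundary = LinearMap.ker M.mulVecLin := by
    ext z
    rw [LinearMap.mem_ker, Matrix.mulVecLin_apply, hM, ← isEvenChain_iff]
    constructor
    · rintro ⟨q, rfl⟩
      exact (E.isBoundary_faceBoundary q).isEvenChain
    · exact fun hz => (h z hz).mem_range
  have h2 : LinearMap.ker M.transpose.mulVecLin = componentFunctions G := by
    ext P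
    rw [LinearMap.mem_ker, Matrix.mulVecLin_apply, funext_iff]
    simp only [hM, transpose_incidence_mulVec, Pi.zero_apply, CharTwo.add_eq_zero]
    constructor
    · intro hP u v huv
      have := hP (Dart.toEdge ⟨(u, v), huv⟩)
      rcases edgeDart_toEdge (⟨(u, v), huv⟩ : G.Dart) with hd | hd
      · rw [hd] at this
        exact this
      · rw [hd] at this
        exact this.symm
    · exact fun hP e => hP _ _ (edgeDart e).adj
  -- With c components, boundaries have dimension (faces) - c and even edge sets |E| - |V| + c; the
  -- latter uses that row and column rank agree.
  have e1 := M.mulVecLin.finrank_range_add_finrank_ker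
  have e2 := M.transpose.mulVecLin.finrank_range_add_finrank_ker
  have e3 := E.faceBoundary.finrank_range_add_finrank_ker
  have e4 : Module.finrank (ZMod 2) (LinearMap.range M.transpose.mulVecLin)
      = Module.finrank (ZMod 2) (LinearMap.range M.mulVecLin) := M.rank_transpose
  rw [← h1, Module.finrank_fintype_fun_eq_card] at e1
  rw [h2, finrank_componentFunctions, e4, Module.finrank_fintype_fun_eq_card] at e2
  rw [finrank_ker_faceBoundary, Module.finrank_fintype_fun_eq_card] at e3
  unfold eulerGenus
  rw [Nat.card_eq_fintype_card (α := V), Nat.card_eq_fintype_card (α := G.edgeSet),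
    Face, Nat.card_eq_fintype_card
      (α := E.FacialWalk ⊕ {v : V // ∀ w, ¬ G.Adj v w})]
  omega

end Genus

section Restrict

variable {V V' : Type*} {G : SimpleGraph V} {H : SimpleGraph V'}

theorem mapDart_injective {f : H →g G} (hf : Function.Injective f) :
    Function.Injective f.mapDart := by
  intro d d' h
  have h1 := congrArg Dart.toProd h
  exact Dart.ext _ _ (Prod.ext (hf (congrArg Prod.fst h1)) (hf (congrArg Prod.snd h1)))

theorem toEdge_mapDart (f : H →g G) (d : H.Dart) : (f.mapDart d).toEdge = f.mapEdgeSet d.toEdge :=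
  rfl

/-- A subgraph all of whose even edge sets are boundaries in an embedded graph is planar. -/
theorem isPlanar_of_hom [Finite V] [Finite V'] [Fintype G.Dart] (E : G.EmbeddingScheme)
    (f : H →g G) (hf : Function.Injective f)
    (h : ∀ z : G.edgeSet → ZMod 2, IsEvenChain z →
      (∀ d ∉ Set.range f.mapDart, z d.toEdge = 0) → E.IsBoundary z) : H.IsPlanar := by
  classical
  have := Fintype.ofFinite H.Dart
  have hmap := mapDart_injective hf
  obtain ⟨π, hπ, hcycle⟩ := E.rot.exists_firstReturn hmap
  have hpow : ∀ (n : ℕ) (d : G.Dart), ((E.rot ^ n) d).fst = d.fst := by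
    intro n d
    induction n with
    | zero => rfl
    | succ n ih => rw [pow_succ', Equiv.Perm.mul_apply, E.fst_rot, ih]
  let E' : H.EmbeddingScheme :=
    { rot := π
      fst_rot := fun d => by
        obtain ⟨k, hk, -⟩ := hπ d
        apply hf
        change (f.mapDart (π d)).fst = (f.mapDart d).fst
        rw [hk, hpow]
      sameCycle_rot := fun d d' hdd => hcycle _ _ (E.sameCycle_rot _ _ (congrArg f hdd))
      sign := fun e => E.sign (f.mapEdgeSet e) }
  refine ⟨E', E'.eulerGenus_eq_zero fun z hz => ?_⟩
  have hinj : Function.Injective f.mapEdgeSet := Hom.mapEdgeSet.injective f hf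
  set z' : G.edgeSet → ZMod 2 := Function.extend f.mapEdgeSet z 0 with hz'
  have hz1 : ∀ d : H.Dart, z' (f.mapDart d).toEdge = z d.toEdge := fun d =>
    hinj.extend_apply z 0 d.toEdge
  have hz2 : ∀ d ∉ Set.range f.mapDart, z' d.toEdge = 0 := by
    intro d hd
    refine Function.extend_apply' _ _ _ ?_
    rintro ⟨e, he⟩
    rw [← toEdge_edgeDart e, ← toEdge_mapDart, Dart.toEdge_eq_iff] at he
    rcases he with he | he
    · exact hd ⟨_, he⟩
    · exact hd ⟨(edgeDart e).symm, by rw [← d.symm_symm, ← he]; rfl⟩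
  obtain ⟨φ, hφ, hzφ⟩ := h z' (fun P => by
    rw [← hz (fun v => P (f v))]
    refine (Fintype.sum_of_injective f.mapDart hmap _ _ (fun d hd => ?_) fun d => ?_).symm
    · rw [hz2 d hd, mul_zero]
    · rw [hz1]
      rfl) hz2
  -- Between consecutive darts of `H` the rotation skips only edges on which `z'` vanishes, so `φ`
  -- does not change across them.
  have hrot : ∀ d : H.Dart, φ (f.mapDart (π d), 1) = φ (f.mapDart d, -1) := by
    intro d
    obtain ⟨k, hk, hk2⟩ := hπ d
    rw [hk]
    have key : ∀ j ≤ k, φ ((E.rot ^ (j + 1)) (f.mapDart d), 1) = φ (f.mapDart d, -1) := by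
      intro j
      induction j with
      | zero =>
        intro _
        rw [zero_add, pow_one, ← cornerFlip_neg_one, hφ.1]
      | succ j ih =>
        intro hj
        rw [← ih (by omega), pow_succ', Equiv.Perm.mul_apply, ← cornerFlip_neg_one, hφ.1, eq_comm,
          ← CharTwo.add_eq_zero, ← hzφ]
        exact hz2 _ (hk2 j (by omega))
    exact key k le_rfl
  refine ⟨fun x => φ (f.mapDart x.1, x.2), ⟨?_, fun x => hφ.2 (f.mapDart x.1, x.2)⟩, fun d => ?_⟩
  · rintro ⟨d, ε⟩
    rcases Int.units_eq_one_or ε with rfl | rfl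
    · obtain ⟨d, rfl⟩ := π.surjective d
      rw [cornerFlip_one]
      have h1 : π⁻¹ (π d) = d := π.symm_apply_apply d
      change φ (f.mapDart (π⁻¹ (π d)), -1) = _
      rw [h1]
      exact (hrot d).symm
    · rw [cornerFlip_neg_one]
      exact hrot d
  · rw [← hz1, hzφ]

end Restrict

end EmbeddingScheme
end SimpleGraph

/-! ### Tree decompositions of layered graphs -/

namespace SimpleGraph

variable {V : Type*} {G : SimpleGraph V}

/-- Two trees joined by an edge form a tree. -/
theorem IsTree.sum_sup_edge {N M : Type*} [Finite N] [Finite M] {S : SimpleGraph N}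
    {T : SimpleGraph M} (hS : S.IsTree) (hT : T.IsTree) (x : N) (y : M) :
    (S.sum T ⊔ edge (.inl x) (.inr y)).IsTree := by
  have hconn : (S.sum T ⊔ edge (Sum.inl x) (Sum.inr y)).Connected :=
    hS.connected.sum_sup_edge hT.connected
  rw [isTree_iff_connected_and_card]
  refine ⟨hconn, le_antisymm ?_ hconn.card_vert_le_card_edgeSet_add_one⟩
  have h1 := (isTree_iff_connected_and_card.1 hS).2
  have h2 := (isTree_iff_connected_and_card.1 hT).2
  have h3 : Nat.card (S.sum T).edgeSet = Nat.card S.edgeSet + Nat.card T.edgeSet := by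
    rw [Nat.card_congr edgeSetSumEquiv, Nat.card_sum]
  have h4 : Nat.card (S.sum T ⊔ edge (Sum.inl x) (Sum.inr y)).edgeSet ≤
      Nat.card (S.sum T).edgeSet + 1 := by
    rw [edgeSet_sup]
    refine (Set.ncard_union_le _ _).trans (Nat.add_le_add_left ?_ _)
    rw [edgeSet_edge]
    exact (Set.ncard_le_ncard Set.sdiff_subset).trans (Set.ncard_singleton _).le
  rw [Nat.card_sum]
  omega

theorem Connected.induce_image {N M : Type*} {S : SimpleGraph N} {T : SimpleGraph M}
    (f : S →g T) {s : Set N} (hs : (S.induce s).Connected) : (T.induce (f '' s)).Connected := by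
  let F : S.induce s →g T.induce (f '' s) :=
    ⟨fun x => ⟨f x.1, x.1, x.2, rfl⟩, fun {x y} h => f.map_adj h⟩
  refine hs.map F ?_
  rintro ⟨_, x, hx, rfl⟩
  exact ⟨⟨x, hx⟩, rfl⟩

namespace Subgraph

/-- A subgraph has a tree decomposition with bags of size at most `n`, one of which
contains `Q`. -/
def HasTreeDecomposition (H : G.Subgraph) (n : ℕ) (Q : Set V) : Prop :=
  ∃ (N : Type) (_ : Finite N) (T : SimpleGraph N) (bag : N → Finset V), T.IsTree ∧
    (∀ z, (bag z : Set V) ⊆ H.verts) ∧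
    (∀ u v, H.Adj u v → ∃ z, u ∈ bag z ∧ v ∈ bag z) ∧
    (∀ v ∈ H.verts, (T.induce {z | v ∈ bag z}).Connected) ∧
    (∀ z, (bag z).card ≤ n) ∧ ∃ z, Q ⊆ bag z

theorem hasTreeDecomposition_of_ncard_le [Finite V] {H : G.Subgraph} {n : ℕ}
    (hn : H.verts.ncard ≤ n) : H.HasTreeDecomposition n H.verts := by
  have hfin := H.verts.toFinite
  have hmem : ∀ v, v ∈ hfin.toFinset ↔ v ∈ H.verts := fun v => hfin.mem_toFinset
  refine ⟨Unit, inferInstance, ⊥, fun _ => hfin.toFinset, IsTree.of_subsingleton,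
    fun _ => by simp, fun u v h => ⟨(), ?_⟩, fun v hv => ?_, fun _ => ?_, (), by simp⟩
  · simp only [hmem]
    exact ⟨h.fst_mem, h.snd_mem⟩
  · have : Nonempty ({z : Unit | v ∈ hfin.toFinset} : Set Unit) := ⟨⟨(), (hmem v).2 hv⟩⟩
    refine ⟨fun x y => ?_⟩
    rw [Subsingleton.elim x y]
  · rwa [← Set.ncard_eq_toFinset_card]

/-- Gluing two tree decompositions along a common bag. -/
theorem HasTreeDecomposition.sup {H₁ H₂ : G.Subgraph} {n : ℕ} {P Q : Set V}
    (h₁ : H₁.HasTreeDecomposition n Q) (h₂ : H₂.HasTreeDecomposition n P) (hPQ : P ⊆ Q)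
    (hP : H₁.verts ∩ H₂.verts ⊆ P) : (H₁ ⊔ H₂).HasTreeDecomposition n Q := by
  obtain ⟨N₁, _, T₁, bag₁, hT₁, hsub₁, hadj₁, hconn₁, hcard₁, z₁, hz₁⟩ := h₁
  obtain ⟨N₂, _, T₂, bag₂, hT₂, hsub₂, hadj₂, hconn₂, hcard₂, z₂, hz₂⟩ := h₂
  -- Common vertices lie in `P ⊆ Q`, hence in both bags joined by the new edge, which connects their
  -- two subtrees.
  let T := T₁.sum T₂ ⊔ edge (Sum.inl z₁) (Sum.inr z₂)
  let f₁ : T₁ →g T := (Hom.ofLE le_sup_left).comp Embedding.sumInl.toHom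
  let f₂ : T₂ →g T := (Hom.ofLE le_sup_left).comp Embedding.sumInr.toHom
  have hz : T.Adj (Sum.inl z₁) (Sum.inr z₂) := Or.inr (by simp [edge])
  have hset : ∀ v, {z | v ∈ Sum.elim bag₁ bag₂ z} =
      f₁ '' {z | v ∈ bag₁ z} ∪ f₂ '' {z | v ∈ bag₂ z} := by
    intro v
    ext (z | z) <;> simp [f₁, f₂]
  have hempty₁ : ∀ v ∉ H₁.verts, {z | v ∈ bag₁ z} = ∅ := fun v hv =>
    Set.eq_empty_of_forall_notMem fun z hz => hv (hsub₁ z hz)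
  have hempty₂ : ∀ v ∉ H₂.verts, {z | v ∈ bag₂ z} = ∅ := fun v hv =>
    Set.eq_empty_of_forall_notMem fun z hz => hv (hsub₂ z hz)
  refine ⟨N₁ ⊕ N₂, inferInstance, T, Sum.elim bag₁ bag₂, hT₁.sum_sup_edge hT₂ z₁ z₂,
    ?_, ?_, ?_, ?_, Sum.inl z₁, hz₁⟩
  · rintro (z | z)
    · exact (hsub₁ z).trans Set.subset_union_left
    · exact (hsub₂ z).trans Set.subset_union_right
  · rintro u v (h | h)
    · obtain ⟨z, hz⟩ := hadj₁ u v h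
      exact ⟨Sum.inl z, hz⟩
    · obtain ⟨z, hz⟩ := hadj₂ u v h
      exact ⟨Sum.inr z, hz⟩
  · intro v hv
    rw [hset]
    by_cases hv₁ : v ∈ H₁.verts
    · by_cases hv₂ : v ∈ H₂.verts
      · have hvP := hP ⟨hv₁, hv₂⟩
        have e₁ : (Sum.inl z₁ : N₁ ⊕ N₂) ∈ f₁ '' {z | v ∈ bag₁ z} := ⟨z₁, hz₁ (hPQ hvP), rfl⟩
        have e₂ : (Sum.inr z₂ : N₁ ⊕ N₂) ∈ f₂ '' {z | v ∈ bag₂ z} := ⟨z₂, hz₂ hvP, rfl⟩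
        have c₁ := SimpleGraph.induce_union_connected ((hconn₁ v hv₁).induce_image f₁).preconnected
          (SimpleGraph.induce_pair_connected_of_adj hz).preconnected ⟨_, e₁, Set.mem_insert _ _⟩
        have c₂ := SimpleGraph.induce_union_connected c₁.preconnected
          ((hconn₂ v hv₂).induce_image f₂).preconnected
          ⟨_, Or.inr (Set.mem_insert_of_mem _ rfl), e₂⟩
        have : f₁ '' {z | v ∈ bag₁ z} ∪ {Sum.inl z₁, Sum.inr z₂} ∪ f₂ '' {z | v ∈ bag₂ z} =
            f₁ '' {z | v ∈ bag₁ z} ∪ f₂ '' {z | v ∈ bag₂ z} := by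
          refine subset_antisymm (Set.union_subset (Set.union_subset Set.subset_union_left ?_)
            Set.subset_union_right)
            (Set.union_subset_union_left _ Set.subset_union_left)
          rintro z (rfl | rfl)
          · exact Or.inl e₁
          · exact Or.inr e₂
        rwa [this] at c₂
      · rw [hempty₂ v hv₂, Set.image_empty, Set.union_empty]
        exact (hconn₁ v hv₁).induce_image f₁
    · rw [hempty₁ v hv₁, Set.image_empty, Set.empty_union]
      exact (hconn₂ v (hv.resolve_left hv₁)).induce_image f₂
  · rintro (z | z)
    · exact hcard₁ z
    · exact hcard₂ z

/-- Adding the set `P` to all bags of a tree decomposition. -/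
theorem hasTreeDecomposition_sup_of_treewidth_le [Finite V] {H K : G.Subgraph} {a k : ℕ}
    (hK : K.coe.treewidth ≤ a) (hH : H.verts.ncard ≤ k) :
    (K ⊔ H).HasTreeDecomposition (a + 1 + k) H.verts := by
  classical
  obtain ⟨D, hD⟩ := (treewidth_le_iff _ _).1 hK
  have hfin := H.verts.toFinite
  have hmem : ∀ v, v ∈ hfin.toFinset ↔ v ∈ H.verts := fun v => hfin.mem_toFinset
  have hbag : ∀ (v : V) (hv : v ∈ K.verts) z, v ∈ (D.bag z).map (Function.Embedding.subtype _) ↔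
      ⟨v, hv⟩ ∈ D.bag z := by
    intro v hv z
    simp [hv]
  have := D.finite_node
  refine ⟨D.Node, D.finite_node, D.tree,
    fun z => (D.bag z).map (Function.Embedding.subtype _) ∪ hfin.toFinset, D.isTree, ?_, ?_, ?_, ?_,
    D.isTree.connected.nonempty.some, ?_⟩
  · intro z v hv
    rcases Finset.mem_union.1 hv with hv | hv
    · obtain ⟨w, -, rfl⟩ := Finset.mem_map.1 hv
      exact Or.inl w.2
    · exact Or.inr ((hmem v).1 hv)
  · rintro u v (h | h)
    · obtain ⟨z, hu, hv⟩ := D.exists_bag_of_adj ⟨u, h.fst_mem⟩ ⟨v, h.snd_mem⟩ h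
      exact ⟨z, Finset.mem_union_left _ ((hbag _ _ z).2 hu),
        Finset.mem_union_left _ ((hbag _ _ z).2 hv)⟩
    · exact ⟨D.isTree.connected.nonempty.some, Finset.mem_union_right _ ((hmem u).2 h.fst_mem),
        Finset.mem_union_right _ ((hmem v).2 h.snd_mem)⟩
  · intro v hv
    by_cases hvH : v ∈ H.verts
    · have : {z | v ∈ (D.bag z).map (Function.Embedding.subtype _) ∪ hfin.toFinset}
          = Set.univ := by
        ext z
        simp [hvH]
      rw [this]
      exact (induceUnivIso D.tree).symm.connected_iff.1 D.isTree.connected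
    · have hvK : v ∈ K.verts := hv.resolve_right hvH
      have : {z | v ∈ (D.bag z).map (Function.Embedding.subtype _) ∪ hfin.toFinset}
          = {z | ⟨v, hvK⟩ ∈ D.bag z} := by
        ext z
        rw [Set.mem_ofPred_eq, Finset.mem_union, hbag v hvK, hmem]
        simp [hvH]
      rw [this]
      exact D.connected_nodes _
  · intro z
    refine (Finset.card_union_le _ _).trans (Nat.add_le_add ?_ ?_)
    · rw [Finset.card_map]
      exact hD z
    · rwa [← Set.ncard_eq_toFinset_card]
  · intro v hv
    exact Finset.mem_union_right _ ((hmem v).2 hv)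

theorem HasTreeDecomposition.mono_card {H : G.Subgraph} {n n' : ℕ} {Q : Set V}
    (h : H.HasTreeDecomposition n Q) (hn : n ≤ n') : H.HasTreeDecomposition n' Q := by
  obtain ⟨N, hN, T, bag, hT, hsub, hadj, hconn, hcard, hz⟩ := h
  exact ⟨N, hN, T, bag, hT, hsub, hadj, hconn, fun z => (hcard z).trans hn, hz⟩

theorem HasTreeDecomposition.mono_set {H : G.Subgraph} {n : ℕ} {Q Q' : Set V}
    (h : H.HasTreeDecomposition n Q) (hQ : Q' ⊆ Q) : H.HasTreeDecomposition n Q' := by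
  obtain ⟨N, hN, T, bag, hT, hsub, hadj, hconn, hcard, z, hz⟩ := h
  exact ⟨N, hN, T, bag, hT, hsub, hadj, hconn, hcard, z, hQ.trans hz⟩

theorem HasTreeDecomposition.treewidth_le [Finite V] {H J : G.Subgraph} {n : ℕ} {Q : Set V}
    (h : H.HasTreeDecomposition (n + 1) Q) (hverts : J.verts = H.verts)
    (hJ : ∀ u v, J.Adj u v → H.Adj u v) : J.coe.treewidth ≤ n := by
  classical
  obtain ⟨N, hN, T, bag, hT, hsub, hadj, hconn, hcard, -⟩ := h
  refine (treewidth_le_iff _ _).2 ⟨⟨N, hN, T, hT, fun z => (bag z).subtype (· ∈ J.verts),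
    fun u v huv => ?_, fun v => ?_⟩, fun z => ?_⟩
  · obtain ⟨z, hu, hv⟩ := hadj u v (hJ u v huv)
    exact ⟨z, by simpa using hu, by simpa using hv⟩
  · have h : {z | v ∈ (bag z).subtype (· ∈ J.verts)} = {z | v.1 ∈ bag z} := by
      ext z
      simp
    rw [h]
    exact hconn v (hverts ▸ v.2)
  · exact (Finset.card_subtype _ _).trans_le ((Finset.card_filter_le _ _).trans (hcard z))

/-- The tree-width of a layered subgraph with few vertices in each layer together
with disjoint graphs attached at layer `0`. -/
theorem treewidth_induce_sup_iSup_le [Finite V] {m a k b : ℕ} {G₀ : G.Subgraph}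
    {K : Fin m → G.Subgraph} {L : Set V} (hL : L ⊆ G₀.verts) {level : V → ℕ}
    (hlevel : ∀ u v, G₀.Adj u v → level u ≤ level v + 1)
    (hdisj : ∀ i j, i ≠ j → Disjoint (K i).verts (K j).verts)
    (hK : ∀ i, ∀ v ∈ (K i).verts, v ∈ G₀.verts → level v = 0)
    (htw : ∀ i, (K i).coe.treewidth ≤ a)
    (hk : ∀ n, (L ∩ {v | level v = n}).ncard ≤ k)
    (hkb : 2 * k ≤ b + 1) (hab : a + 1 + k ≤ b + 1) :
    ((G₀.induce L) ⊔ ⨆ i, K i).coe.treewidth ≤ b := by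
  classical
  -- The `K i` are disjoint, so after adding layer 0 of `L` to each of them they overlap exactly in
  -- that layer and can be glued along it.
  have hzero : ∀ s : Finset (Fin m), ∃ H : G.Subgraph,
      H.HasTreeDecomposition (b + 1) (L ∩ {v | level v = 0}) ∧
      H.verts = (L ∩ {v | level v = 0}) ∪ ⋃ i ∈ s, (K i).verts ∧
      G₀.induce (L ∩ {v | level v = 0}) ≤ H ∧ ∀ i ∈ s, K i ≤ H := by
    intro s
    induction s using Finset.induction with
    | empty =>
      refine ⟨G₀.induce (L ∩ {v | level v = 0}), hasTreeDecomposition_of_ncard_le ?_, by simp,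
        le_rfl, by simp⟩
      exact (hk 0).trans (by omega)
    | insert i s hi ih =>
      obtain ⟨H, h1, h2, h3, h4⟩ := ih
      have hC := (hasTreeDecomposition_sup_of_treewidth_le (htw i)
        (H := G₀.induce (L ∩ {v | level v = 0})) (hk 0)).mono_card hab
      refine ⟨_, hC.sup h1 subset_rfl ?_, ?_, h3.trans le_sup_right, fun j hj => ?_⟩
      · rintro v ⟨hv | hv, hv2⟩
        · rw [h2] at hv2
          rcases hv2 with hv2 | hv2
          · exact hv2
          · simp only [Set.mem_iUnion] at hv2
            obtain ⟨j, hj, hv2⟩ := hv2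
            exact absurd hv2 (Set.disjoint_left.1 (hdisj i j (by rintro rfl; exact hi hj)) hv)
        · exact hv
      · rw [verts_sup, verts_sup, h2, Finset.set_biUnion_insert, induce_verts]
        ext v
        simp only [Set.mem_union]
        tauto
      · rcases Finset.mem_insert.1 hj with rfl | hj
        · exact le_sup_left.trans le_sup_left
        · exact (h4 j hj).trans le_sup_right
  -- Each step adds one bag made of layers `n` and `n + 1`. It meets the earlier part in layer `n`
  -- only, because the `K i` meet `G₀` in layer 0.
  have hlayers : ∀ n : ℕ, ∃ H : G.Subgraph,
      H.HasTreeDecomposition (b + 1) (L ∩ {v | level v = n}) ∧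
      H.verts = (L ∩ {v | level v ≤ n}) ∪ ⋃ i, (K i).verts ∧
      (∀ i, K i ≤ H) ∧
      ∀ u ∈ L, ∀ v ∈ L, G₀.Adj u v → level u ≤ n → level v ≤ n → H.Adj u v := by
    intro n
    induction n with
    | zero =>
      obtain ⟨H, h1, h2, h3, h4⟩ := hzero Finset.univ
      refine ⟨H, h1, by simpa using h2, fun i => h4 i (Finset.mem_univ i),
        fun u hu v hv huv hun hvn => h3.2 ?_⟩
      exact ⟨⟨hu, Nat.le_zero.1 hun⟩, ⟨hv, Nat.le_zero.1 hvn⟩, huv⟩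
    | succ n ih =>
      obtain ⟨H, h1, h2, h3, h4⟩ := ih
      set S : Set V := (L ∩ {v | level v = n}) ∪ (L ∩ {v | level v = n + 1}) with hS
      have hC : (G₀.induce S).HasTreeDecomposition (b + 1) S := by
        refine hasTreeDecomposition_of_ncard_le ((Set.ncard_union_le _ _).trans ?_)
        have := hk n
        have := hk (n + 1)
        omega
      refine ⟨_, (hC.sup h1 Set.subset_union_left ?_).mono_set Set.subset_union_right, ?_,
        fun i => (h3 i).trans le_sup_right, fun u hu v hv huv hun hvn => ?_⟩
      · rintro v ⟨hv | hv, hv2⟩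
        · exact hv
        · exfalso
          have hvn : level v = n + 1 := hv.2
          rw [h2] at hv2
          rcases hv2 with hv2 | hv2
          · have : level v ≤ n := hv2.2
            omega
          · simp only [Set.mem_iUnion] at hv2
            obtain ⟨i, hi⟩ := hv2
            have := hK i v hi (hL hv.1)
            omega
      · rw [verts_sup, h2, induce_verts]
        ext v
        simp only [hS, Set.mem_union, Set.mem_inter_iff, Set.mem_ofPred_eq]
        have : level v ≤ n + 1 ↔ level v = n ∨ level v = n + 1 ∨ level v ≤ n := by omega
        rw [this]
        tauto
      · have e1 := hlevel u v huv
        have e2 := hlevel v u huv.symm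
        by_cases hle : level u ≤ n ∧ level v ≤ n
        · exact Or.inr (h4 u hu v hv huv hle.1 hle.2)
        · refine Or.inl ⟨?_, ?_, huv⟩
          · have : level u = n ∨ level u = n + 1 := by omega
            exact this.imp (fun h => ⟨hu, h⟩) fun h => ⟨hu, h⟩
          · have : level v = n ∨ level v = n + 1 := by omega
            exact this.imp (fun h => ⟨hv, h⟩) fun h => ⟨hv, h⟩
  obtain ⟨n, hn⟩ := (Set.finite_range level).bddAbove
  replace hn : ∀ v, level v ≤ n := fun v => hn ⟨v, rfl⟩
  obtain ⟨H, h1, h2, h3, h4⟩ := hlayers n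
  refine h1.treewidth_le ?_ ?_
  · rw [h2, verts_sup, induce_verts, verts_iSup]
    congr 1
    ext v
    simp [hn v]
  · rintro u v (⟨hu, hv, huv⟩ | h)
    · exact h4 u hu v hv huv (hn u) (hn v)
    · rw [iSup_adj] at h
      obtain ⟨i, hi⟩ := h
      exact (h3 i).2 hi

end Subgraph
end SimpleGraph

/-! ### Degenerate cases and conclusion -/

namespace SimpleGraph
namespace EmbeddingScheme

/-- Variant of `exists_vertical_set` for a possibly empty family of faces of a graph
that may consist of a single vertex. -/
theorem exists_vertical_set_of_faces {V : Type*} {G : SimpleGraph V} [Finite V]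
    [Fintype G.Dart] (hG : G.Connected) (E : G.EmbeddingScheme) {g m : ℕ}
    (hg : E.eulerGenus = g) (f : Fin m → E.Face) :
    ∃ (L : Set V) (level : V → ℕ), (∀ u v, G.Adj u v → level u ≤ level v + 1) ∧
      (∀ i, ∀ v ∈ E.boundary (f i), level v = 0) ∧
      (∀ n, (L ∩ {v | level v = n}).ncard ≤ 2 * (g + max m 1 - 1)) ∧
      ∀ z : G.edgeSet → ZMod 2, IsEvenChain z → (∀ d : G.Dart, d.fst ∈ L → z d.toEdge = 0) →
        E.IsBoundary z := by
  classical
  rcases isEmpty_or_nonempty G.Dart with hemp | ⟨⟨d₀⟩⟩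
  · exact ⟨∅, fun _ => 0, fun _ _ _ => by simp, fun _ _ _ => rfl, fun n => by simp,
      fun z _ _ => ⟨0, ⟨fun _ => rfl, fun _ => rfl⟩, fun d => hemp.elim d⟩⟩
  have hinl : ∀ q : E.Face, ∃ w : E.FacialWalk, q = Sum.inl w := by
    rintro (w | ⟨v, hv⟩)
    · exact ⟨w, rfl⟩
    · have : Nontrivial V := ⟨_, _, d₀.adj.ne⟩
      obtain ⟨w, hw⟩ := hG.preconnected.exists_adj_of_nontrivial v
      exact absurd hw (hv w)
  choose q hq using fun i => hinl (f i)
  have : Finite E.FacialWalk := Quot.finite _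
  -- The forest needs a root: if `m = 0` an arbitrary face serves, whence `max m 1`.
  let F : Set E.FacialWalk := if m = 0 then {E.facialWalk (d₀, 1)} else Set.range q
  have hF : F.Nonempty := by
    by_cases hm : m = 0
    · simp [F, hm]
    · have : Nonempty (Fin m) := ⟨⟨0, Nat.pos_of_ne_zero hm⟩⟩
      simp only [F, if_neg hm]
      exact Set.range_nonempty q
  have hFcard : F.ncard ≤ max m 1 := by
    by_cases hm : m = 0
    · simp [F, hm]
    · simp only [F, if_neg hm]
      have h := Set.ncard_image_le (f := q) (Set.finite_univ)
      rw [Set.image_univ, Set.ncard_univ, Nat.card_fin] at h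
      exact h.trans (le_max_left _ _)
  obtain ⟨L, level, h1, h2, h3, h4⟩ := exists_vertical_set hG hg hF
  refine ⟨L, level, h1, fun i v hv => ?_, fun n => (h3 n).trans (by omega), h4⟩
  rw [hq i] at hv
  refine h2 (q i) ?_ v hv
  have hm : m ≠ 0 := by
    rintro rfl
    exact i.elim0
  simp only [F, if_neg hm]
  exact ⟨i, rfl⟩

end EmbeddingScheme
end SimpleGraph

theorem mainTheorem12 {V : Type*} [Finite V] (g a m : ℕ) (G : SimpleGraph V)
    (G₀ : G.Subgraph) (K : Fin m → G.Subgraph)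
    (hG : G₀ ⊔ ⨆ i, K i = ⊤)
    (hdisj : ∀ i j, i ≠ j → Disjoint (K i).verts (K j).verts)
    (hedge : ∀ i j, i ≠ j → ∀ u ∈ (K i).verts, ∀ v ∈ (K j).verts, ¬ G.Adj u v)
    (hconn : G₀.coe.Connected) (E : G₀.coe.EmbeddingScheme) (hgenus : E.eulerGenus = g)
    (f : Fin m → E.Face) (hf : Function.Injective f)
    (hK : ∀ (i : Fin m) (v : G₀.verts), (v : V) ∈ (K i).verts → v ∈ E.boundary (f i))
    (htw : ∀ i, (K i).coe.treewidth ≤ a) :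
    ∃ L₀ : Set V, L₀ ⊆ G₀.verts ∧ (G₀.deleteVerts L₀).coe.IsPlanar ∧
      ((G₀.induce L₀) ⊔ ⨆ i, K i).coe.treewidth ≤ 26 * g + 9 * m + a := by
  classical
  have := Fintype.ofFinite G₀.coe.Dart
  obtain ⟨L, level, h1, h2, h3, h4⟩ := E.exists_vertical_set_of_faces hconn hgenus f
  -- The value outside `G₀` plays no role, since only levels of vertices of `G₀` are compared.
  let level' : V → ℕ := fun v => if h : v ∈ G₀.verts then level ⟨v, h⟩ else 0
  have hlevel' : ∀ v : G₀.verts, level' v = level v := fun v => dif_pos v.2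
  have hL : Subtype.val '' L ⊆ G₀.verts := by
    rintro _ ⟨v, -, rfl⟩
    exact v.2
  refine ⟨Subtype.val '' L, hL, ?_, ?_⟩
  · let i : (G₀.deleteVerts (Subtype.val '' L)).coe →g G₀.coe :=
      SimpleGraph.Subgraph.inclusion SimpleGraph.Subgraph.deleteVerts_le
    refine E.isPlanar_of_hom i (SimpleGraph.Subgraph.inclusion.injective _) fun z hz hz0 =>
      h4 z hz fun d hd => hz0 d ?_
    rintro ⟨d', rfl⟩
    exact d'.fst.2.2 ⟨_, hd, rfl⟩
  -- Here k ≤ 2g + 2m, so the bag sizes 2k and a + 1 + k stay within the bound with room to spare.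
  · have hb := SimpleGraph.Subgraph.treewidth_induce_sup_iSup_le (G₀ := G₀) (K := K) (a := a)
      (k := 2 * (g + max m 1 - 1)) (b := 26 * g + 9 * m + a) hL (level := level')
      (fun u v huv => ?_) hdisj (fun i v hv hv0 => ?_) htw (fun n => ?_) (by omega) (by omega)
    · exact_mod_cast hb
    · have := h1 ⟨u, huv.fst_mem⟩ ⟨v, huv.snd_mem⟩ huv
      rwa [← hlevel', ← hlevel'] at this
    · have := h2 i ⟨v, hv0⟩ (hK i ⟨v, hv0⟩ hv)
      rwa [← hlevel'] at this
    · refine le_trans ?_ (h3 n)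
      have : Subtype.val '' L ∩ {v | level' v = n} ⊆ Subtype.val '' (L ∩ {v | level v = n}) := by
        rintro _ ⟨⟨v, hv, rfl⟩, hn⟩
        exact ⟨v, ⟨hv, (hlevel' v).symm.trans hn⟩, rfl⟩
      exact (Set.ncard_le_ncard this).trans (Set.ncard_image_le (Set.toFinite _))
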